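/- Let $\mathbb T$ be the unit circle $\{z\in\mathbb C: |z|=1\}$, and let $p$ be the usual (normalized) Lebesgue measure on the two-torus $\mathbb T^2$, equipped with its Lebesgue measurable sets. Let $1<r\le\infty$, and define $\alpha_1(x,y)=(y,x)$ and $\alpha_2(x,y)=(x,xy)$ for $(x,y)\in\mathbb T^2$. Let $L_r(\mathbb T^2)$ be the Lebesgue space of $p$, with either real or complex scalars. Then for every $f\in L_r(\mathbb T^2)$ with $\int_{\mathbb T^2} f\,dp=0$ there exist $h_1,h_2\in L_r(\mathbb T^2)$ such that $$f = h_1-h_1\circ\alpha_1+h_2-h_2\circ\alpha_2$$ $p$-almost everywhere, i.e. as elements of $L_r(\mathbb T^2)$. -/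

import Mathlib

open MeasureTheory
open scoped ENNReal

noncomputable instance instMeasurableSpaceUnitCircle : MeasurableSpace Circle := borel Circle

instance instBorelSpaceUnitCircle : BorelSpace Circle := ⟨rfl⟩

/-- The normalized Lebesgue measure on the unit circle of `ℂ`: the image of Lebesgue measure on
`ℝ / ℤ` under `t ↦ exp (2 π i t)`. -/
noncomputable def circleLebesgue : Measure Circle :=
  (volume : Measure UnitAddCircle).map (fun t => AddCircle.toCircle t)

/-- The usual Lebesgue probability measure on the two-torus. -/
noncomputable def torusLebesgue : Measure (Circle × Circle) :=
  circleLebesgue.prod circleLebesgue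

/-- The flip `(x, y) ↦ (y, x)` of the two-torus. -/
def torusFlip (z : Circle × Circle) : Circle × Circle := (z.2, z.1)

/-- The shear `(x, y) ↦ (x, x y)` of the two-torus. -/
noncomputable def torusShear (z : Circle × Circle) : Circle × Circle := (z.1, z.1 * z.2)

/-!
The flip and the shear of the two-torus generate an action of `GL₂(ℤ)`, and the theorem is a
consequence of the spectral gap of this action on `L²`, transported to the other exponents.

*Spectral gap.* The Fourier transform turns the two maps into the swap and the shear of `ℤ²`, acting
by permutations on `ℓ²(ℤ² \ {0})`. If `a` is nearly invariant there, then `b = ‖a‖²` is a nearly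
invariant mass distribution in `ℓ¹`. The shear carries the pair of open quadrants `m n < 0` into its
part `|m| > |n|`, and the swap carries that part to a disjoint part of the same pair, so the pair has
little mass; the other quadrants and the axes are similar (`tsum_le_of_apply_zero_eq_zero`). With
Parseval's identity this yields `hasSpectralGap_torus`.

*Other exponents.* For a real mean-zero `g`, let `F = sign g * |g| ^ (q / 2)`. The gap applies to
`F` minus its mean, and the mean of `F` is itself controlled because `g` has mean zero
(`mul_sq_le_integral_sq_signedPow_sub`). So `∫ |g| ^ q` is bounded by the quadratic energy of `F`,
for each `q ≥ 1` (`HasSpectralGap.exists_integral_abs_rpow_le`).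

*The case `1 < r < ∞`.* By the Stroock–Varopoulos inequality the energy of `F` is at most a multiple
of the pairing of `L g` with `sign g * |g| ^ (r - 1)`, where
`L = 4 - (U_α + U_α⁻¹ + U_β + U_β⁻¹)`. So `t + L` is bounded below on mean-zero functions uniformly
in `t ≥ 0`. It is invertible for `t > 0`, and letting `t → 0` shows that `L` is onto the mean-zero
functions (`exists_smul_sub_eq_of_coercive`). Since `2 - U - U⁻¹ = (1 - U) (1 - U⁻¹)`, the range of
`L` consists of sums of two coboundaries.

*The case `r = ∞`.* No lower bound for `L` on `L^∞` is used. The case `q = 1` of the energy bound is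
a Poincaré inequality in `L¹`, and a Hahn–Banach argument dualizes it to the solvability of the
equation in `L^∞` (`HasSpectralGap.exists_coboundaries_top`).

Complex functions are treated through their real and imaginary parts.
-/

/-! ### Odd power functions -/

/-- The odd power function `a ↦ sign a * |a| ^ s` on the real line. -/
noncomputable def signedPow (s a : ℝ) : ℝ := if 0 ≤ a then a ^ s else -(-a) ^ s

theorem signedPow_of_nonneg {s a : ℝ} (ha : 0 ≤ a) : signedPow s a = a ^ s := if_pos ha

theorem signedPow_neg {s : ℝ} (hs : s ≠ 0) (a : ℝ) : signedPow s (-a) = -signedPow s a := by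
  unfold signedPow
  rcases lt_trichotomy a 0 with h | rfl | h
  · rw [if_pos (by linarith), if_neg (by linarith), neg_neg]
  · simp [Real.zero_rpow hs]
  · rw [if_neg (by linarith), if_pos h.le, neg_neg]

theorem signedPow_mul_of_nonneg {s k : ℝ} (hs : s ≠ 0) (hk : 0 ≤ k) (a : ℝ) :
    signedPow s (k * a) = k ^ s * signedPow s a := by
  rcases le_total 0 a with ha | ha
  · rw [signedPow_of_nonneg ha, signedPow_of_nonneg (mul_nonneg hk ha), Real.mul_rpow hk ha]
  · have h : 0 ≤ -a := by linarith
    rw [← neg_neg a, mul_neg, signedPow_neg hs, signedPow_neg hs, signedPow_of_nonneg h,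
      signedPow_of_nonneg (mul_nonneg hk h), Real.mul_rpow hk h, mul_neg]

theorem abs_signedPow (s a : ℝ) : |signedPow s a| = |a| ^ s := by
  unfold signedPow
  split_ifs with h
  · rw [abs_of_nonneg h, abs_of_nonneg (by positivity)]
  · push Not at h
    rw [abs_neg, abs_of_neg h, abs_of_nonneg (Real.rpow_nonneg (by linarith) _)]

theorem sq_signedPow (s a : ℝ) : signedPow s a ^ 2 = |a| ^ (2 * s) := by
  rw [← sq_abs, abs_signedPow, mul_comm, Real.rpow_mul (abs_nonneg a), Real.rpow_two]

theorem self_mul_signedPow {s : ℝ} (hs : 0 ≤ s) (a : ℝ) :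
    a * signedPow s a = |a| ^ (s + 1) := by
  unfold signedPow
  split_ifs with h
  · rw [abs_of_nonneg h, Real.rpow_add_of_nonneg h hs zero_le_one, Real.rpow_one, mul_comm]
  · push Not at h
    rw [abs_of_neg h, Real.rpow_add_of_nonneg (by linarith) hs zero_le_one, Real.rpow_one]
    ring

theorem measurable_signedPow (s : ℝ) : Measurable (signedPow s) :=
  Measurable.ite measurableSet_Ici (by fun_prop) (by fun_prop)

/-- Weighted arithmetic-geometric mean inequality for `y ^ q` and `x ^ (q / 2) * y ^ (q / 2)`. For
`θ = |q - 2| / q` the exponents on the left are `1` and `q - 1`. -/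
theorem mul_rpow_le_weighted {q θ x y : ℝ} (hq : 0 < q) (h0 : 0 ≤ θ) (h1 : θ ≤ 1) (hx : 0 ≤ x)
    (hy : 0 ≤ y) :
    x ^ (q / 2 * (1 - θ)) * y ^ (q / 2 * (1 + θ)) ≤
      θ * y ^ q + (1 - θ) * (x ^ (q / 2) * y ^ (q / 2)) := by
  have h := Real.geom_mean_le_arith_mean2_weighted h0 (sub_nonneg.2 h1)
    (Real.rpow_nonneg hy q)
    (mul_nonneg (Real.rpow_nonneg hx (q / 2)) (Real.rpow_nonneg hy (q / 2))) (by ring)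
  refine le_trans (le_of_eq ?_) h
  have h1' := sub_nonneg.2 h1
  rw [Real.mul_rpow (Real.rpow_nonneg hx _) (Real.rpow_nonneg hy _), ← Real.rpow_mul hx,
    ← Real.rpow_mul hy, ← Real.rpow_mul hy,
    show q / 2 * (1 + θ) = q * θ + q / 2 * (1 - θ) by ring,
    Real.rpow_add_of_nonneg hy (by positivity) (by positivity)]
  ring

/-- The Stroock–Varopoulos inequality for two nonnegative numbers, with its products expanded. -/
theorem mul_rpow_add_rpow_mul_le {q : ℝ} (hq : 1 < q) :
    ∃ θ : ℝ, 0 ≤ θ ∧ θ < 1 ∧ ∀ x y : ℝ, 0 ≤ x → 0 ≤ y →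
      x * y ^ (q - 1) + x ^ (q - 1) * y ≤
        θ * (x ^ q + y ^ q) + 2 * (1 - θ) * (x ^ (q / 2) * y ^ (q / 2)) := by
  have hq0 : 0 < q := by linarith
  rcases le_total 2 q with h2 | h2
  · have e1 : q / 2 * (1 - (q - 2) / q) = 1 := by field_simp; ring
    have e2 : q / 2 * (1 + (q - 2) / q) = q - 1 := by field_simp; ring
    have t0 : 0 ≤ (q - 2) / q := div_nonneg (by linarith) hq0.le
    have t1 : (q - 2) / q < 1 := by rw [div_lt_one hq0]; linarith
    refine ⟨(q - 2) / q, t0, t1, fun x y hx hy => ?_⟩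
    have A := mul_rpow_le_weighted hq0 t0 t1.le hx hy
    have B := mul_rpow_le_weighted hq0 t0 t1.le hy hx
    rw [e1, e2, Real.rpow_one] at A B
    linarith
  · have e1 : q / 2 * (1 - (2 - q) / q) = q - 1 := by field_simp; ring
    have e2 : q / 2 * (1 + (2 - q) / q) = 1 := by field_simp; ring
    have t0 : 0 ≤ (2 - q) / q := div_nonneg (by linarith) hq0.le
    have t1 : (2 - q) / q < 1 := by rw [div_lt_one hq0]; linarith
    refine ⟨(2 - q) / q, t0, t1, fun x y hx hy => ?_⟩
    have A := mul_rpow_le_weighted hq0 t0 t1.le hx hy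
    have B := mul_rpow_le_weighted hq0 t0 t1.le hy hx
    rw [e1, e2, Real.rpow_one] at A B
    linarith

/-- An odd-function inequality only has to be checked for two nonnegative numbers, and for two
numbers of opposite signs. -/
theorem forall_of_nonneg_of_neg {P : ℝ → ℝ → Prop} (hsymm : ∀ a b, P a b → P b a)
    (hneg : ∀ a b, P a b → P (-a) (-b)) (h₁ : ∀ x y, 0 ≤ x → 0 ≤ y → P x y)
    (h₂ : ∀ x y, 0 ≤ x → 0 ≤ y → P x (-y)) (a b : ℝ) : P a b := by
  rcases le_total 0 a with ha | ha <;> rcases le_total 0 b with hb | hb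
  · exact h₁ a b ha hb
  · simpa using h₂ a (-b) ha (by linarith)
  · exact hsymm _ _ (by simpa using h₂ b (-a) hb (by linarith))
  · simpa using hneg _ _ (h₁ (-a) (-b) (by linarith) (by linarith))

/-- The Stroock–Varopoulos inequality, pointwise: the `L^q` energy of a function dominates the
quadratic energy of its signed power of exponent `q / 2`. -/
theorem exists_mul_sq_signedPow_sub_le {q : ℝ} (hq : 1 < q) :
    ∃ c : ℝ, 0 < c ∧ ∀ a b : ℝ, c * (signedPow (q / 2) a - signedPow (q / 2) b) ^ 2 ≤
      (a - b) * (signedPow (q - 1) a - signedPow (q - 1) b) := by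
  obtain ⟨θ, h0, h1, H⟩ := mul_rpow_add_rpow_mul_le hq
  have hq1 : q - 1 ≠ 0 := by linarith
  have hq2 : q / 2 ≠ 0 := by linarith
  have e1 : ∀ x : ℝ, 0 ≤ x → x * x ^ (q - 1) = x ^ q := fun x hx => by
    have := self_mul_signedPow (by linarith : 0 ≤ q - 1) x
    rwa [signedPow_of_nonneg hx, abs_of_nonneg hx, sub_add_cancel] at this
  have e2 : ∀ x : ℝ, 0 ≤ x → (x ^ (q / 2)) ^ 2 = x ^ q := fun x hx => by
    have := sq_signedPow (q / 2) x
    rwa [signedPow_of_nonneg hx, abs_of_nonneg hx, mul_div_cancel₀ _ two_ne_zero] at this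
  -- the factor `2` pays for the pairs of opposite signs
  refine ⟨(1 - θ) / 2, by linarith, forall_of_nonneg_of_neg ?_ ?_ ?_ ?_⟩
  · intro a b h; linarith
  · intro a b h
    rw [signedPow_neg hq1, signedPow_neg hq1, signedPow_neg hq2, signedPow_neg hq2]
    linarith
  · intro x y hx hy
    rw [signedPow_of_nonneg hx, signedPow_of_nonneg hx, signedPow_of_nonneg hy,
      signedPow_of_nonneg hy]
    have := H x y hx hy
    have := e1 x hx
    have := e1 y hy
    have := e2 x hx
    have := e2 y hy
    nlinarith [mul_nonneg (sub_nonneg.2 h1.le) (sq_nonneg (x ^ (q / 2) - y ^ (q / 2)))]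
  · intro x y hx hy
    rw [signedPow_neg hq1, signedPow_neg hq2, signedPow_of_nonneg hx, signedPow_of_nonneg hx,
      signedPow_of_nonneg hy, signedPow_of_nonneg hy]
    have := e1 x hx
    have := e1 y hy
    have := e2 x hx
    have := e2 y hy
    have : 0 ≤ x * y ^ (q - 1) := by positivity
    have : 0 ≤ y * x ^ (q - 1) := by positivity
    have : 0 ≤ x ^ (q / 2) * y ^ (q / 2) := by positivity
    nlinarith [mul_nonneg (sub_nonneg.2 h1.le) (sq_nonneg (x ^ (q / 2) - y ^ (q / 2))),
      sq_nonneg (x ^ (q / 2) - y ^ (q / 2)), mul_nonneg h0 (sq_nonneg (x ^ (q / 2) + y ^ (q / 2)))]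

/-- The limiting case `q = 1` of the Stroock–Varopoulos inequality, read as an upper bound for the
quadratic energy. -/
theorem sq_signedPow_half_sub_le (a b : ℝ) :
    (signedPow (1 / 2) a - signedPow (1 / 2) b) ^ 2 ≤ 2 * |a - b| := by
  revert a b
  have hh : (1 / 2 : ℝ) ≠ 0 := by norm_num
  refine forall_of_nonneg_of_neg ?_ ?_ ?_ ?_
  · intro a b h; rw [abs_sub_comm]; linarith
  · intro a b h
    rw [signedPow_neg hh, signedPow_neg hh, abs_sub_comm,
      show -b - -a = a - b by ring]
    linarith
  · intro x y hx hy
    rw [signedPow_of_nonneg hx, signedPow_of_nonneg hy, ← Real.sqrt_eq_rpow, ← Real.sqrt_eq_rpow]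
    have := Real.sq_sqrt hx
    have := Real.sq_sqrt hy
    have := Real.sqrt_nonneg x
    have := Real.sqrt_nonneg y
    rcases le_total x y with h | h
    · have := Real.sqrt_le_sqrt h
      rw [abs_of_nonpos (by linarith)]
      nlinarith
    · have := Real.sqrt_le_sqrt h
      rw [abs_of_nonneg (by linarith)]
      nlinarith
  · intro x y hx hy
    rw [signedPow_neg hh, signedPow_of_nonneg hx, signedPow_of_nonneg hy, ← Real.sqrt_eq_rpow,
      ← Real.sqrt_eq_rpow, abs_of_nonneg (by linarith)]
    have := Real.sq_sqrt hx
    have := Real.sq_sqrt hy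
    nlinarith [sq_nonneg (√x - √y)]

/-- The affine function on the left takes the value `c` at the mean `0`, so integrating this
inequality shows that the signed power of a mean-zero function stays away from the constant `1`. -/
theorem exists_affine_le_sq_signedPow_sub_one {q : ℝ} (hq : 1 ≤ q) :
    ∃ c : ℝ, 0 < c ∧ ∀ s : ℝ, c * (1 - 2 * s) ≤ (signedPow (q / 2) s - 1) ^ 2 := by
  have hq2 : 0 < q / 2 := by linarith
  set d : ℝ := (1 / 2 : ℝ) ^ (q / 2)
  have hd0 : 0 < d := by positivity
  have hd1 : d < 1 := Real.rpow_lt_one (by norm_num) (by norm_num) hq2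
  have hc : 0 < (1 - d) ^ 2 := pow_pos (by linarith) 2
  refine ⟨(1 - d) ^ 2 / 3, by positivity, fun s => ?_⟩
  rcases le_total (1 / 2) s with h | h
  · have : (1 - d) ^ 2 / 3 * (1 - 2 * s) ≤ 0 :=
      mul_nonpos_of_nonneg_of_nonpos (by positivity) (by linarith)
    exact this.trans (sq_nonneg _)
  rcases le_total 0 s with h0 | h0
  · rw [signedPow_of_nonneg h0]
    have : s ^ (q / 2) ≤ d := Real.rpow_le_rpow h0 h hq2.le
    have h3 : (1 - d) ^ 2 ≤ (s ^ (q / 2) - 1) ^ 2 := by nlinarith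
    nlinarith
  · have hs : signedPow (q / 2) s = -(-s) ^ (q / 2) := by
      rw [← signedPow_of_nonneg (by linarith : 0 ≤ -s), signedPow_neg hq2.ne', neg_neg]
    set t := -s with ht
    have ht0 : 0 ≤ t := by linarith
    have e2 : (t ^ (q / 2)) ^ 2 = t ^ q := by
      rw [← Real.rpow_two, ← Real.rpow_mul ht0, div_mul_cancel₀ _ two_ne_zero]
    have hp : 0 ≤ t ^ (q / 2) := by positivity
    have hle : t ≤ 1 + t ^ q := by
      rcases le_total t 1 with h1 | h1
      · have : 0 ≤ t ^ q := by positivity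
        linarith
      · have := Real.rpow_le_rpow_of_exponent_le h1 hq
        rw [Real.rpow_one] at this
        linarith
    have h1 : (1 - d) ^ 2 ≤ 1 := by nlinarith
    have hs' : s = -t := by linarith
    rw [hs, hs']
    nlinarith [mul_le_mul_of_nonneg_right h1 (by linarith : 0 ≤ 1 + 2 * t)]

/-! ### Spectral gaps and signed powers -/

/-- The `L²` spectral gap (Poincaré inequality) with constant `C` of two transformations `α`, `β` of
a probability space: the variance of a square-integrable function is at most `C` times the sum of
its two squared displacements. -/
def HasSpectralGap {X : Type*} [MeasurableSpace X] (μ : Measure X) (α β : X → X) (C : ℝ) : Prop :=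
  ∀ u : X → ℝ, MemLp u 2 μ → ∫ x, u x ∂μ = 0 →
    ∫ x, u x ^ 2 ∂μ ≤ C * (∫ x, (u x - u (α x)) ^ 2 ∂μ + ∫ x, (u x - u (β x)) ^ 2 ∂μ)

section

variable {X : Type*} [MeasurableSpace X] {μ : Measure X}

theorem integrable_abs_rpow_of_memLp {p : ℝ} (hp : 0 < p) {g : X → ℝ}
    (hg : MemLp g (ENNReal.ofReal p) μ) : Integrable (fun x => |g x| ^ p) μ := by
  simpa [ENNReal.toReal_ofReal hp.le] using hg.integrable_norm_rpow (by simpa using hp) (by simp)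

theorem memLp_signedPow {p q s : ℝ} (hp : 0 < p) (hq : 0 < q) (h : s * q = p) {g : X → ℝ}
    (hg : MemLp g (ENNReal.ofReal p) μ) :
    MemLp (fun x => signedPow s (g x)) (ENNReal.ofReal q) μ := by
  have hm : AEStronglyMeasurable (fun x => signedPow s (g x)) μ :=
    ((measurable_signedPow s).comp_aemeasurable hg.1.aemeasurable).aestronglyMeasurable
  rw [← integrable_norm_rpow_iff hm (by simpa using hq) (by simp), ENNReal.toReal_ofReal hq.le]
  refine (integrable_abs_rpow_of_memLp hp hg).congr (ae_of_all _ fun x => ?_)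
  simp only
  rw [Real.norm_eq_abs, abs_signedPow, ← Real.rpow_mul (abs_nonneg _), h]

theorem memLp_two_signedPow {q : ℝ} (hq : 0 < q) {g : X → ℝ}
    (hg : MemLp g (ENNReal.ofReal q) μ) : MemLp (fun x => signedPow (q / 2) (g x)) 2 μ := by
  simpa using memLp_signedPow hq two_pos (div_mul_cancel₀ q two_ne_zero) hg

variable [IsProbabilityMeasure μ]

/-- A signed power of a mean-zero function is not `L²`-close to a nonzero constant. -/
theorem mul_sq_le_integral_sq_signedPow_sub {q c : ℝ} (hq : 1 ≤ q)
    (hc : ∀ s : ℝ, c * (1 - 2 * s) ≤ (signedPow (q / 2) s - 1) ^ 2)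
    {g : X → ℝ} (hg : MemLp g (ENNReal.ofReal q) μ) (hg0 : ∫ x, g x ∂μ = 0) (m : ℝ) :
    c * m ^ 2 ≤ ∫ x, (signedPow (q / 2) (g x) - m) ^ 2 ∂μ := by
  have hq2 : q / 2 ≠ 0 := by linarith
  wlog hm : 0 ≤ m generalizing g m
  · have h := this hg.neg (by simp [integral_neg, hg0]) (-m) (by linarith)
    rw [neg_sq] at h
    refine h.trans (le_of_eq (integral_congr_ae (ae_of_all _ fun x => ?_)))
    simp only [Pi.neg_apply]
    rw [signedPow_neg hq2]
    ring
  rcases hm.eq_or_lt with rfl | hm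
  · have : 0 ≤ ∫ x, (signedPow (q / 2) (g x) - 0) ^ 2 ∂μ := integral_nonneg fun x => sq_nonneg _
    simpa using this
  -- rescale so that `m` becomes `1`
  set k : ℝ := m ^ (-(q / 2)⁻¹) with hk
  have hk0 : 0 ≤ k := by positivity
  have hkm : k ^ (q / 2) = m⁻¹ := by
    rw [hk, ← Real.rpow_mul hm.le, neg_mul, inv_mul_cancel₀ hq2, Real.rpow_neg_one]
  have hgi : Integrable g μ := hg.integrable (by simpa using hq)
  have hF : MemLp (fun x => signedPow (q / 2) (g x) - m) 2 μ :=
    (memLp_two_signedPow (by linarith) hg).sub (memLp_const m)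
  have h1 : ∀ x, m ^ 2 * (c * (1 - 2 * (k * g x))) ≤ (signedPow (q / 2) (g x) - m) ^ 2 := by
    intro x
    have h := mul_le_mul_of_nonneg_left (hc (k * g x)) (sq_nonneg m)
    rw [signedPow_mul_of_nonneg hq2 hk0, hkm, ← mul_pow] at h
    refine h.trans (le_of_eq ?_)
    rw [mul_sub m, mul_inv_cancel_left₀ hm.ne', mul_one]
  have hi : Integrable (fun x => m ^ 2 * (c * (1 - 2 * (k * g x)))) μ :=
    (((integrable_const 1).sub ((hgi.const_mul k).const_mul 2)).const_mul c).const_mul _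
  have h2 := integral_mono hi hF.integrable_sq h1
  refine le_trans (le_of_eq ?_) h2
  rw [integral_const_mul, integral_const_mul,
    integral_sub (integrable_const 1) ((hgi.const_mul k).const_mul 2), integral_const_mul,
    integral_const_mul, hg0]
  simp
  ring

/-- A spectral gap in `L²` bounds the `L^q` norm of a mean-zero function by the quadratic energy of
its signed power of exponent `q / 2`, for each `q ≥ 1`. -/
theorem HasSpectralGap.exists_integral_abs_rpow_le {α β : X → X} {C : ℝ}
    (H : HasSpectralGap μ α β C) {q : ℝ} (hq : 1 ≤ q) :
    ∃ K : ℝ, 0 < K ∧ ∀ g : X → ℝ, MemLp g (ENNReal.ofReal q) μ → ∫ x, g x ∂μ = 0 →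
      ∫ x, |g x| ^ q ∂μ ≤
        K * (∫ x, (signedPow (q / 2) (g x) - signedPow (q / 2) (g (α x))) ^ 2 ∂μ +
          ∫ x, (signedPow (q / 2) (g x) - signedPow (q / 2) (g (β x))) ^ 2 ∂μ) := by
  obtain ⟨c, hc0, hc⟩ := exists_affine_le_sq_signedPow_sub_one hq
  refine ⟨(2 + 2 / c) * max C 1, by positivity, fun g hg hg0 => ?_⟩
  set F : X → ℝ := fun x => signedPow (q / 2) (g x)
  have hF2 : MemLp F 2 μ := memLp_two_signedPow (by linarith) hg
  set m : ℝ := ∫ x, F x ∂μ with hm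
  have hFm : MemLp (fun x => F x - m) 2 μ := hF2.sub (memLp_const m)
  have h1 := H _ hFm (by
    rw [integral_sub (hF2.integrable one_le_two) (integrable_const m)]
    simp [hm])
  simp only [sub_sub_sub_cancel_right] at h1
  have h2 : c * m ^ 2 ≤ ∫ x, (F x - m) ^ 2 ∂μ :=
    mul_sq_le_integral_sq_signedPow_sub hq hc hg hg0 m
  have h3 : ∫ x, |g x| ^ q ∂μ ≤ 2 * (∫ x, (F x - m) ^ 2 ∂μ) + 2 * m ^ 2 := by
    have : ∫ x, (2 * (F x - m) ^ 2 + 2 * m ^ 2) ∂μ =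
        2 * (∫ x, (F x - m) ^ 2 ∂μ) + 2 * m ^ 2 := by
      rw [integral_add (hFm.integrable_sq.const_mul 2) (integrable_const _), integral_const_mul]
      simp
    rw [← this]
    refine integral_mono (integrable_abs_rpow_of_memLp (by linarith) hg)
      ((hFm.integrable_sq.const_mul 2).add (integrable_const _)) fun x => ?_
    have h := sq_signedPow (q / 2) (g x)
    rw [mul_div_cancel₀ _ two_ne_zero] at h
    simp only
    rw [← h]
    change F x ^ 2 ≤ _
    nlinarith [sq_nonneg (F x - 2 * m)]
  set S : ℝ := ∫ x, (F x - F (α x)) ^ 2 ∂μ + ∫ x, (F x - F (β x)) ^ 2 ∂μ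
  have hS0 : 0 ≤ S := add_nonneg (integral_nonneg fun x => sq_nonneg _)
    (integral_nonneg fun x => sq_nonneg _)
  set I := ∫ x, (F x - m) ^ 2 ∂μ
  have h4 : I ≤ max C 1 * S := h1.trans (mul_le_mul_of_nonneg_right (le_max_left _ _) hS0)
  have h5 : m ^ 2 ≤ I / c := by rw [le_div_iff₀ hc0]; linarith
  calc ∫ x, |g x| ^ q ∂μ ≤ 2 * I + 2 * (I / c) := by linarith
    _ = (2 + 2 / c) * I := by ring
    _ ≤ (2 + 2 / c) * (max C 1 * S) := mul_le_mul_of_nonneg_left h4 (by positivity)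
    _ = _ := by ring

end

/-! ### The Laplacian on `L^p` for `1 < p < ∞` -/

/-- A coercive perturbation of a contraction is onto the kernel of an invariant functional: solve
the equation with `k + t` in place of `k` by a Neumann series, and let `t` tend to `0`. -/
theorem exists_smul_sub_eq_of_coercive {E : Type*} [NormedAddCommGroup E] [NormedSpace ℝ E]
    [CompleteSpace E] (B : E →L[ℝ] E) {k κ : ℝ} (hk : 0 < k) (hB : ‖B‖ ≤ k) (ℓ : E →ₗ[ℝ] ℝ)
    (hℓ : ∀ x, ℓ (B x) = k * ℓ x) (hκ : 0 < κ)
    (hco : ∀ t : ℝ, 0 ≤ t → ∀ x, ℓ x = 0 → κ * ‖x‖ ≤ ‖(k + t) • x - B x‖)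
    {y : E} (hy : ℓ y = 0) : ∃ x, k • x - B x = y := by
  have hsolve : ∀ t : ℝ, 0 < t → ∃ x, ℓ x = 0 ∧ (k + t) • x - B x = y := by
    intro t ht
    have hmem : k + t ∈ resolventSet ℝ B := by
      refine spectrum.mem_resolventSet_of_norm_lt_mul ?_
      have h1 : ‖(1 : E →L[ℝ] E)‖ ≤ 1 := ContinuousLinearMap.norm_id_le
      calc ‖B‖ * ‖(1 : E →L[ℝ] E)‖ ≤ ‖B‖ * 1 := mul_le_mul_of_nonneg_left h1 (norm_nonneg _)
        _ < ‖k + t‖ := by rw [Real.norm_of_nonneg (by linarith)]; linarith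
    obtain ⟨v, hv⟩ := (spectrum.mem_resolventSet_iff.1 hmem).exists_right_inv
    have hx : (k + t) • v y - B (v y) = y := by
      have := congrArg (fun T : E →L[ℝ] E => T y) hv
      simpa [Algebra.algebraMap_eq_smul_one] using this
    refine ⟨v y, ?_, hx⟩
    have := congrArg ℓ hx
    rw [map_sub, map_smul, hℓ, hy, smul_eq_mul] at this
    -- applying `ℓ` to the equation leaves only the shift
    have h0 : t * ℓ (v y) = 0 := by linarith
    exact (mul_eq_zero.1 h0).resolve_left ht.ne'
  have hpos : ∀ n : ℕ, 0 < 1 / ((n : ℝ) + 1) := fun n => Nat.one_div_pos_of_nat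
  choose x hx0 hx using fun n : ℕ => hsolve _ (hpos n)
  have hbd : ∀ n, ‖x n‖ ≤ ‖y‖ / κ := fun n => by
    rw [le_div_iff₀ hκ, mul_comm, ← hx n]
    exact hco _ (hpos n).le _ (hx0 n)
  have hlim : Filter.Tendsto (fun n => k • x n - B (x n)) Filter.atTop (nhds y) := by
    have h1 : ∀ n, k • x n - B (x n) = y - (1 / ((n : ℝ) + 1)) • x n := fun n => by
      have := hx n
      rw [add_smul] at this
      rw [← this]
      abel
    simp_rw [h1]
    have h2 : Filter.Tendsto (fun n : ℕ => (1 / ((n : ℝ) + 1)) • x n) Filter.atTop (nhds 0) := by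
      refine squeeze_zero_norm (a := fun n : ℕ => 1 / ((n : ℝ) + 1) * (‖y‖ / κ)) (fun n => ?_) ?_
      · rw [norm_smul, Real.norm_of_nonneg (hpos n).le]
        exact mul_le_mul_of_nonneg_left (hbd n) (hpos n).le
      · simpa using tendsto_one_div_add_atTop_nhds_zero_nat.mul_const (‖y‖ / κ)
    simpa using tendsto_const_nhds.sub h2
  have hcauchy : CauchySeq x := by
    have hc := hlim.cauchySeq
    rw [Metric.cauchySeq_iff] at hc ⊢
    intro ε hε
    obtain ⟨N, hN⟩ := hc (κ * ε) (by positivity)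
    refine ⟨N, fun m hm n hn => ?_⟩
    have h1 := hN m hm n hn
    have h2 := hco 0 le_rfl (x m - x n) (by rw [map_sub, hx0, hx0, sub_zero])
    rw [dist_eq_norm] at h1 ⊢
    rw [add_zero, smul_sub, map_sub, sub_sub_sub_comm] at h2
    exact lt_of_mul_lt_mul_left (h2.trans_lt h1) hκ.le
  obtain ⟨z, hz⟩ := cauchySeq_tendsto_of_complete hcauchy
  refine ⟨z, tendsto_nhds_unique ?_ hlim⟩
  exact (hz.const_smul k).sub ((B.continuous.tendsto z).comp hz)

section

variable {X : Type*} [MeasurableSpace X] {μ : Measure X}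

/-- Summation by parts for an invertible measure-preserving transformation. -/
theorem integral_second_difference_mul {α : X ≃ᵐ X} (hα : MeasurePreserving α μ μ) {p q : ℝ}
    (hpq : p.HolderConjugate q) {g φ : X → ℝ} (hg : MemLp g (ENNReal.ofReal p) μ)
    (hφ : MemLp φ (ENNReal.ofReal q) μ) :
    Integrable (fun x => (2 * g x - g (α x) - g (α.symm x)) * φ x) μ ∧
    Integrable (fun x => (g x - g (α x)) * (φ x - φ (α x))) μ ∧
    ∫ x, (2 * g x - g (α x) - g (α.symm x)) * φ x ∂μ =
      ∫ x, (g x - g (α x)) * (φ x - φ (α x)) ∂μ := by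
  have := hpq.ennrealOfReal
  have hgα : MemLp (fun x => g (α x)) (ENNReal.ofReal p) μ := hg.comp_measurePreserving hα
  have hgα' : MemLp (fun x => g (α.symm x)) (ENNReal.ofReal p) μ :=
    hg.comp_measurePreserving hα.symm
  have hφα : MemLp (fun x => φ (α x)) (ENNReal.ofReal q) μ := hφ.comp_measurePreserving hα
  have i1 : Integrable (fun x => g x * φ x) μ := hg.integrable_mul hφ
  have i2 : Integrable (fun x => g (α x) * φ x) μ := hgα.integrable_mul hφ
  have i3 : Integrable (fun x => g (α.symm x) * φ x) μ := hgα'.integrable_mul hφ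
  have i4 : Integrable (fun x => g x * φ (α x)) μ := hg.integrable_mul hφα
  have i5 : Integrable (fun x => g (α x) * φ (α x)) μ := hgα.integrable_mul hφα
  have e1 : ∀ x, (2 * g x - g (α x) - g (α.symm x)) * φ x =
      2 * (g x * φ x) - g (α x) * φ x - g (α.symm x) * φ x := fun x => by ring
  have e2 : ∀ x, (g x - g (α x)) * (φ x - φ (α x)) =
      g x * φ x - g (α x) * φ x - g x * φ (α x) + g (α x) * φ (α x) := fun x => by ring
  have h5 : ∫ x, g (α x) * φ (α x) ∂μ = ∫ x, g x * φ x ∂μ :=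
    hα.integral_comp' fun x => g x * φ x
  have h4 : ∫ x, g x * φ (α x) ∂μ = ∫ x, g (α.symm x) * φ x ∂μ := by
    have := hα.integral_comp' fun x => g (α.symm x) * φ x
    simpa using this
  simp_rw [e1, e2]
  have j1 : Integrable (fun x => 2 * (g x * φ x) - g (α x) * φ x) μ := (i1.const_mul 2).sub i2
  have j2 : Integrable (fun x => g x * φ x - g (α x) * φ x) μ := i1.sub i2
  have j3 : Integrable (fun x => g x * φ x - g (α x) * φ x - g x * φ (α x)) μ := j2.sub i4
  refine ⟨j1.sub i3, j3.add i5, ?_⟩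
  rw [integral_sub j1 i3, integral_sub (i1.const_mul 2) i2, integral_const_mul,
    integral_add j3 i5, integral_sub j2 i4, integral_sub i1 i2, h4, h5]
  ring

theorem norm_rpow_eq_integral_abs_rpow {p : ℝ} (hp : 0 < p) (g : Lp ℝ (ENNReal.ofReal p) μ) :
    ‖g‖ ^ p = ∫ x, |g x| ^ p ∂μ := by
  have h0 : 0 ≤ ∫ x, |g x| ^ p ∂μ :=
    integral_nonneg fun x => Real.rpow_nonneg (abs_nonneg _) _
  rw [Lp.norm_def, (Lp.memLp g).eLpNorm_eq_integral_rpow_norm (by simpa using hp) (by simp),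
    ENNReal.toReal_ofReal hp.le]
  simp only [Real.norm_eq_abs]
  rw [ENNReal.toReal_ofReal (Real.rpow_nonneg h0 _), ← Real.rpow_mul h0, inv_mul_cancel₀ hp.ne',
    Real.rpow_one]

/-- Hölder's inequality against the duality map of `L^p`. -/
theorem integral_mul_signedPow_le {p : ℝ} (hp : 1 < p) (w g : Lp ℝ (ENNReal.ofReal p) μ) :
    ∫ x, w x * signedPow (p - 1) (g x) ∂μ ≤ ‖w‖ * ‖g‖ ^ (p - 1) := by
  have hp0 : 0 < p := by linarith
  have hpq := Real.HolderConjugate.conjExponent hp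
  set q := p.conjExponent
  have := hpq.ennrealOfReal
  have hφ : MemLp (fun x => signedPow (p - 1) (g x)) (ENNReal.ofReal q) μ :=
    memLp_signedPow hp0 hpq.symm.pos hpq.sub_one_mul_conj (Lp.memLp g)
  have hw := Lp.memLp w
  have h := integral_mul_le_Lp_mul_Lq_of_nonneg hpq (f := fun x => ‖w x‖)
    (g := fun x => ‖signedPow (p - 1) (g x)‖) (ae_of_all _ fun x => norm_nonneg _)
    (ae_of_all _ fun x => norm_nonneg _) hw.norm hφ.norm
  have e1 : (∫ x, ‖w x‖ ^ p ∂μ) ^ (1 / p) = ‖w‖ := by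
    simp only [Real.norm_eq_abs]
    rw [← norm_rpow_eq_integral_abs_rpow hp0,
      ← Real.rpow_mul (by rw [Lp.norm_def]; exact ENNReal.toReal_nonneg),
      mul_one_div_cancel hp0.ne', Real.rpow_one]
  have e2 : (∫ x, ‖signedPow (p - 1) (g x)‖ ^ q ∂μ) ^ (1 / q) = ‖g‖ ^ (p - 1) := by
    have e3 : ∀ x, ‖signedPow (p - 1) (g x)‖ ^ q = |g x| ^ p := fun x => by
      rw [Real.norm_eq_abs, abs_signedPow, ← Real.rpow_mul (abs_nonneg _), hpq.sub_one_mul_conj]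
    simp_rw [e3]
    have e4 : p * (1 / q) = p - 1 := by
      rw [mul_one_div, div_eq_iff hpq.symm.ne_zero, hpq.sub_one_mul_conj]
    rw [← norm_rpow_eq_integral_abs_rpow hp0,
      ← Real.rpow_mul (by rw [Lp.norm_def]; exact ENNReal.toReal_nonneg), e4]
  rw [e1, e2] at h
  refine le_trans (integral_mono (hw.integrable_mul hφ)
    (hw.norm.integrable_mul hφ.norm) fun x => ?_) h
  simp only [Pi.mul_apply]
  rw [← norm_mul]
  exact Real.le_norm_self _

/-- The Koopman operator `g ↦ g ∘ e` on `L^r`. -/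
noncomputable def koopman (r : ℝ≥0∞) [Fact (1 ≤ r)] {e : X → X} (he : MeasurePreserving e μ μ) :
    Lp ℝ r μ →L[ℝ] Lp ℝ r μ :=
  (Lp.compMeasurePreservingₗᵢ ℝ e he).toContinuousLinearMap

theorem koopman_ae_eq {r : ℝ≥0∞} [Fact (1 ≤ r)] {e : X → X} (he : MeasurePreserving e μ μ)
    (g : Lp ℝ r μ) : koopman r he g =ᵐ[μ] fun x => g (e x) :=
  Lp.coeFn_compMeasurePreserving g he

theorem norm_koopman_le {r : ℝ≥0∞} [Fact (1 ≤ r)] {e : X → X} (he : MeasurePreserving e μ μ) :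
    ‖koopman r he‖ ≤ 1 :=
  ContinuousLinearMap.opNorm_le_bound _ zero_le_one fun g => by
    rw [one_mul]
    exact (Lp.norm_compMeasurePreserving g he).le

/-- The adjacency operator `U_α + U_α⁻¹ + U_β + U_β⁻¹` of two transformations. -/
noncomputable def koopmanSum (r : ℝ≥0∞) [Fact (1 ≤ r)] {α β : X ≃ᵐ X}
    (hα : MeasurePreserving α μ μ) (hβ : MeasurePreserving β μ μ) : Lp ℝ r μ →L[ℝ] Lp ℝ r μ :=
  koopman r hα + koopman r hα.symm + koopman r hβ + koopman r hβ.symm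

theorem koopmanSum_ae_eq {r : ℝ≥0∞} [Fact (1 ≤ r)] {α β : X ≃ᵐ X}
    (hα : MeasurePreserving α μ μ) (hβ : MeasurePreserving β μ μ) (g : Lp ℝ r μ) :
    koopmanSum r hα hβ g =ᵐ[μ] fun x => g (α x) + g (α.symm x) + g (β x) + g (β.symm x) := by
  simp only [koopmanSum, add_apply]
  filter_upwards [Lp.coeFn_add (koopman r hα g + koopman r hα.symm g + koopman r hβ g)
      (koopman r hβ.symm g), Lp.coeFn_add (koopman r hα g + koopman r hα.symm g) (koopman r hβ g),
    Lp.coeFn_add (koopman r hα g) (koopman r hα.symm g), koopman_ae_eq hα g, koopman_ae_eq hβ g,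
    koopman_ae_eq hα.symm g, koopman_ae_eq hβ.symm g] with x h1 h2 h3 h4 h5 h6 h7
  rw [h1, Pi.add_apply, h2, Pi.add_apply, h3, Pi.add_apply, h4, h5, h6, h7]

theorem norm_koopmanSum_le {r : ℝ≥0∞} [Fact (1 ≤ r)] {α β : X ≃ᵐ X}
    (hα : MeasurePreserving α μ μ) (hβ : MeasurePreserving β μ μ) :
    ‖koopmanSum r hα hβ‖ ≤ 4 := by
  have h1 := norm_add_le (koopman r hα + koopman r hα.symm + koopman r hβ) (koopman r hβ.symm)
  have h2 := norm_add_le (koopman r hα + koopman r hα.symm) (koopman r hβ)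
  have h3 := norm_add_le (koopman r hα) (koopman r hα.symm)
  have h4 := norm_koopman_le (r := r) hα
  have h5 := norm_koopman_le (r := r) hβ
  have h6 := norm_koopman_le (r := r) hα.symm
  have h7 := norm_koopman_le (r := r) hβ.symm
  unfold koopmanSum
  linarith

theorem smul_sub_koopmanSum_ae_eq {r : ℝ≥0∞} [Fact (1 ≤ r)] {α β : X ≃ᵐ X}
    (hα : MeasurePreserving α μ μ) (hβ : MeasurePreserving β μ μ) (c : ℝ) (g : Lp ℝ r μ) :
    (c • g - koopmanSum r hα hβ g : Lp ℝ r μ) =ᵐ[μ]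
      fun x => c * g x - (g (α x) + g (α.symm x) + g (β x) + g (β.symm x)) := by
  filter_upwards [Lp.coeFn_sub (c • g) (koopmanSum r hα hβ g), Lp.coeFn_smul c g,
    koopmanSum_ae_eq hα hβ g] with x h4 h5 h6
  rw [h4, Pi.sub_apply, h5, h6, Pi.smul_apply, smul_eq_mul]

variable [IsProbabilityMeasure μ]

/-- Coercivity of the Laplacian `4 - (U_α + U_α⁻¹ + U_β + U_β⁻¹)` and of its positive shifts, tested
against the duality map `g ↦ sign g * |g| ^ (p - 1)` of `L^p`. -/
theorem HasSpectralGap.exists_mul_integral_abs_rpow_le {α β : X ≃ᵐ X} {C : ℝ}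
    (H : HasSpectralGap μ α β C) (hα : MeasurePreserving α μ μ) (hβ : MeasurePreserving β μ μ)
    {p : ℝ} (hp : 1 < p) :
    ∃ κ : ℝ, 0 < κ ∧ ∀ g : X → ℝ, MemLp g (ENNReal.ofReal p) μ → ∫ x, g x ∂μ = 0 →
      ∀ t : ℝ, 0 ≤ t → κ * ∫ x, |g x| ^ p ∂μ ≤
        ∫ x, ((4 + t) * g x - (g (α x) + g (α.symm x) + g (β x) + g (β.symm x))) *
          signedPow (p - 1) (g x) ∂μ := by
  obtain ⟨K, hK0, hK⟩ := H.exists_integral_abs_rpow_le hp.le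
  obtain ⟨c, hc0, hc⟩ := exists_mul_sq_signedPow_sub_le hp
  refine ⟨c / K, by positivity, fun g hg hg0 t ht => ?_⟩
  have hp0 : 0 < p := by linarith
  have hpq := Real.HolderConjugate.conjExponent hp
  set q := p.conjExponent
  have hφ : MemLp (fun x => signedPow (p - 1) (g x)) (ENNReal.ofReal q) μ :=
    memLp_signedPow hp0 hpq.symm.pos hpq.sub_one_mul_conj hg
  obtain ⟨ia, ja, ea⟩ := integral_second_difference_mul hα hpq hg hφ
  obtain ⟨ib, jb, eb⟩ := integral_second_difference_mul hβ hpq hg hφ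
  have hN : Integrable (fun x => |g x| ^ p) μ := integrable_abs_rpow_of_memLp hp0 hg
  have hF2 : MemLp (fun x => signedPow (p / 2) (g x)) 2 μ := memLp_two_signedPow hp0 hg
  have hFα : MemLp (fun x => signedPow (p / 2) (g (α x))) 2 μ := hF2.comp_measurePreserving hα
  have hFβ : MemLp (fun x => signedPow (p / 2) (g (β x))) 2 μ := hF2.comp_measurePreserving hβ
  have hsplit : ∫ x, ((4 + t) * g x - (g (α x) + g (α.symm x) + g (β x) + g (β.symm x))) *
          signedPow (p - 1) (g x) ∂μ =
      ∫ x, (2 * g x - g (α x) - g (α.symm x)) * signedPow (p - 1) (g x) ∂μ +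
      ∫ x, (2 * g x - g (β x) - g (β.symm x)) * signedPow (p - 1) (g x) ∂μ +
      t * ∫ x, |g x| ^ p ∂μ := by
    have iab : Integrable (fun x =>
        (2 * g x - g (α x) - g (α.symm x)) * signedPow (p - 1) (g x) +
        (2 * g x - g (β x) - g (β.symm x)) * signedPow (p - 1) (g x)) μ := ia.add ib
    rw [← integral_const_mul, ← integral_add ia ib, ← integral_add iab (hN.const_mul t)]
    refine integral_congr_ae (ae_of_all _ fun x => ?_)
    have h := self_mul_signedPow (by linarith : 0 ≤ p - 1) (g x)
    rw [sub_add_cancel] at h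
    simp only
    rw [← h]
    ring
  have hA : c * ∫ x, (signedPow (p / 2) (g x) - signedPow (p / 2) (g (α x))) ^ 2 ∂μ ≤
      ∫ x, (g x - g (α x)) * (signedPow (p - 1) (g x) - signedPow (p - 1) (g (α x))) ∂μ := by
    rw [← integral_const_mul]
    exact integral_mono ((hF2.sub hFα).integrable_sq.const_mul c) ja fun x => hc _ _
  have hB : c * ∫ x, (signedPow (p / 2) (g x) - signedPow (p / 2) (g (β x))) ^ 2 ∂μ ≤
      ∫ x, (g x - g (β x)) * (signedPow (p - 1) (g x) - signedPow (p - 1) (g (β x))) ∂μ := by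
    rw [← integral_const_mul]
    exact integral_mono ((hF2.sub hFβ).integrable_sq.const_mul c) jb fun x => hc _ _
  have hN0 : 0 ≤ t * ∫ x, |g x| ^ p ∂μ :=
    mul_nonneg ht (integral_nonneg fun x => Real.rpow_nonneg (abs_nonneg _) _)
  have hmain := mul_le_mul_of_nonneg_left (hK g hg hg0) (by positivity : 0 ≤ c / K)
  rw [← mul_assoc, div_mul_cancel₀ _ hK0.ne', mul_add] at hmain
  rw [hsplit, ea, eb]
  linarith

/-- Integration as a linear functional on `L^r` of a probability space. -/
noncomputable def lpMean (μ : Measure X) [IsProbabilityMeasure μ] (r : ℝ≥0∞) [Fact (1 ≤ r)] :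
    Lp ℝ r μ →ₗ[ℝ] ℝ where
  toFun g := ∫ x, g x ∂μ
  map_add' g g' := by
    rw [← integral_add ((Lp.memLp g).integrable Fact.out) ((Lp.memLp g').integrable Fact.out)]
    exact integral_congr_ae (Lp.coeFn_add g g')
  map_smul' c g := by
    rw [RingHom.id_apply, smul_eq_mul, ← integral_const_mul]
    exact integral_congr_ae (Lp.coeFn_smul c g)

theorem lpMean_apply {r : ℝ≥0∞} [Fact (1 ≤ r)] (g : Lp ℝ r μ) :
    lpMean μ r g = ∫ x, g x ∂μ := rfl

theorem lpMean_koopman {r : ℝ≥0∞} [Fact (1 ≤ r)] {e : X ≃ᵐ X} (he : MeasurePreserving e μ μ)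
    (g : Lp ℝ r μ) : lpMean μ r (koopman r he g) = lpMean μ r g :=
  (integral_congr_ae (koopman_ae_eq he g)).trans (he.integral_comp' fun x => g x)

theorem lpMean_koopmanSum {r : ℝ≥0∞} [Fact (1 ≤ r)] {α β : X ≃ᵐ X}
    (hα : MeasurePreserving α μ μ) (hβ : MeasurePreserving β μ μ) (g : Lp ℝ r μ) :
    lpMean μ r (koopmanSum r hα hβ g) = 4 * lpMean μ r g := by
  simp only [koopmanSum, add_apply]
  rw [map_add, map_add, map_add, lpMean_koopman, lpMean_koopman, lpMean_koopman, lpMean_koopman]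
  ring

/-- On a probability space with a spectral gap, the Laplacian and its positive shifts are bounded
below on the mean-zero part of `L^p`, uniformly in the shift. -/
theorem HasSpectralGap.exists_mul_norm_le {α β : X ≃ᵐ X} {C : ℝ}
    (H : HasSpectralGap μ α β C) (hα : MeasurePreserving α μ μ) (hβ : MeasurePreserving β μ μ)
    {p : ℝ} (hp : 1 < p) [Fact (1 ≤ ENNReal.ofReal p)] :
    ∃ κ : ℝ, 0 < κ ∧ ∀ t : ℝ, 0 ≤ t → ∀ g : Lp ℝ (ENNReal.ofReal p) μ, lpMean μ _ g = 0 →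
      κ * ‖g‖ ≤ ‖(4 + t) • g - koopmanSum _ hα hβ g‖ := by
  obtain ⟨κ, hκ0, hκ⟩ := H.exists_mul_integral_abs_rpow_le hα hβ hp
  refine ⟨κ, hκ0, fun t ht g hg => ?_⟩
  rcases (norm_nonneg g).eq_or_lt with h0 | h0
  · rw [← h0, mul_zero]
    exact norm_nonneg _
  have h1 := hκ g (Lp.memLp g) hg t ht
  have h2 := integral_mul_signedPow_le hp ((4 + t) • g - koopmanSum _ hα hβ g) g
  have h3 : ∫ x, ((4 + t) • g - koopmanSum _ hα hβ g : Lp ℝ (ENNReal.ofReal p) μ) x *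
        signedPow (p - 1) (g x) ∂μ =
      ∫ x, ((4 + t) * g x - (g (α x) + g (α.symm x) + g (β x) + g (β.symm x))) *
        signedPow (p - 1) (g x) ∂μ := by
    refine integral_congr_ae ?_
    filter_upwards [smul_sub_koopmanSum_ae_eq hα hβ (4 + t) g] with x h4
    rw [h4]
  rw [h3] at h2
  have h4 := h1.trans h2
  have h5 : ‖g‖ ^ p = ‖g‖ ^ (p - 1) * ‖g‖ := by
    rw [← Real.rpow_add_one h0.ne', sub_add_cancel]
  rw [← norm_rpow_eq_integral_abs_rpow (by linarith), h5] at h4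
  have h6 : 0 < ‖g‖ ^ (p - 1) := Real.rpow_pos_of_pos h0 _
  refine le_of_mul_le_mul_right ?_ h6
  linarith

/-- On a probability space with a spectral gap, every mean-zero function in `L^p`, `1 < p < ∞`, is
in the range of the Laplacian, and hence a sum of two coboundaries. -/
theorem HasSpectralGap.exists_coboundaries_of_lt_top {α β : X ≃ᵐ X} {C : ℝ}
    (H : HasSpectralGap μ α β C) (hα : MeasurePreserving α μ μ) (hβ : MeasurePreserving β μ μ)
    {p : ℝ} (hp : 1 < p) {f : X → ℝ} (hf : MemLp f (ENNReal.ofReal p) μ)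
    (hf0 : ∫ x, f x ∂μ = 0) :
    ∃ h₁ h₂ : X → ℝ, MemLp h₁ (ENNReal.ofReal p) μ ∧ MemLp h₂ (ENNReal.ofReal p) μ ∧
      ∀ᵐ x ∂μ, f x = h₁ x - h₁ (α x) + h₂ x - h₂ (β x) := by
  have : Fact (1 ≤ ENNReal.ofReal p) := ⟨by simpa using hp.le⟩
  obtain ⟨κ, hκ0, hκ⟩ := H.exists_mul_norm_le hα hβ hp
  obtain ⟨g, hg⟩ := exists_smul_sub_eq_of_coercive (koopmanSum (ENNReal.ofReal p) hα hβ)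
    (by norm_num : (0 : ℝ) < 4) (norm_koopmanSum_le hα hβ) (lpMean μ _)
    (lpMean_koopmanSum hα hβ) hκ0 hκ (y := hf.toLp f)
    (by rw [lpMean_apply, integral_congr_ae hf.coeFn_toLp, hf0])
  -- `2 - U - U⁻¹ = (1 - U) (1 - U⁻¹)`
  have hmem : ∀ e : X ≃ᵐ X, MeasurePreserving e μ μ →
      MemLp (fun x => g x - g (e.symm x)) (ENNReal.ofReal p) μ := fun e he =>
    (Lp.memLp g).sub ((Lp.memLp g).comp_measurePreserving he.symm)
  refine ⟨_, _, hmem α hα, hmem β hβ, ?_⟩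
  have hg' := smul_sub_koopmanSum_ae_eq hα hβ 4 g
  rw [hg] at hg'
  filter_upwards [hf.coeFn_toLp, hg'] with x h1 h2
  rw [← h1, h2, α.symm_apply_apply, β.symm_apply_apply]
  ring

end

/-! ### Bounded functions, by duality with `L¹` -/

/-- A functional dominated by the norm of a linear map factors continuously through that map. -/
theorem exists_strongDual_comp_eq {E F : Type*} [NormedAddCommGroup E] [NormedSpace ℝ E]
    [NormedAddCommGroup F] [NormedSpace ℝ F] (S : E →ₗ[ℝ] F) (ℓ : E →ₗ[ℝ] ℝ) (K : ℝ)
    (h : ∀ x, |ℓ x| ≤ K * ‖S x‖) : ∃ φ : StrongDual ℝ F, ∀ x, φ (S x) = ℓ x := by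
  obtain ⟨s, hs⟩ := S.rangeRestrict.exists_rightInverse_of_surjective S.range_rangeRestrict
  have hs' : ∀ y : S.range, S (s y) = y := fun y =>
    congrArg Subtype.val (LinearMap.congr_fun hs y)
  obtain ⟨φ, hφ, -⟩ := exists_extension_norm_eq S.range
    ((ℓ ∘ₗ s).mkContinuous K fun y => by
      have := h (s y)
      rwa [hs'] at this)
  refine ⟨φ, fun x => ?_⟩
  have h1 := hφ ⟨S x, LinearMap.mem_range_self S x⟩
  have h2 : ℓ (s ⟨S x, LinearMap.mem_range_self S x⟩ - x) = 0 := by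
    have := h (s ⟨S x, LinearMap.mem_range_self S x⟩ - x)
    rw [map_sub S, hs', sub_self, norm_zero, mul_zero] at this
    exact abs_eq_zero.1 (le_antisymm this (abs_nonneg _))
  rw [map_sub, sub_eq_zero] at h2
  exact h1.trans h2

section

variable {X : Type*} [MeasurableSpace X] {μ : Measure X}

/-- Pairing of `L¹` with a function in `L^∞`. -/
noncomputable def l1Pairing {f : X → ℝ} (hf : MemLp f ∞ μ) : Lp ℝ 1 μ →ₗ[ℝ] ℝ where
  toFun g := ∫ x, f x * g x ∂μ
  map_add' g g' := by
    have i : Integrable (fun x => f x * g x) μ := hf.integrable_mul (Lp.memLp g)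
    have i' : Integrable (fun x => f x * g' x) μ := hf.integrable_mul (Lp.memLp g')
    rw [← integral_add i i']
    refine integral_congr_ae ?_
    filter_upwards [Lp.coeFn_add g g'] with x hx
    rw [hx, Pi.add_apply, mul_add]
  map_smul' c g := by
    rw [RingHom.id_apply, smul_eq_mul, ← integral_const_mul]
    refine integral_congr_ae ?_
    filter_upwards [Lp.coeFn_smul c g] with x hx
    simp only [hx, Pi.smul_apply, smul_eq_mul]
    ring

theorem l1Pairing_apply {f : X → ℝ} (hf : MemLp f ∞ μ) (g : Lp ℝ 1 μ) :
    l1Pairing hf g = ∫ x, f x * g x ∂μ := rfl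

theorem norm_sub_koopman_eq {e : X → X} (he : MeasurePreserving e μ μ) (g : Lp ℝ 1 μ) :
    ‖g - koopman 1 he g‖ = ∫ x, |g x - g (e x)| ∂μ := by
  rw [L1.norm_eq_integral_norm]
  refine integral_congr_ae ?_
  filter_upwards [Lp.coeFn_sub g (koopman 1 he g), koopman_ae_eq he g] with x h1 h2
  rw [h1, Pi.sub_apply, h2, Real.norm_eq_abs]

variable [IsProbabilityMeasure μ]

/-- A spectral gap in `L²` implies a Poincaré inequality in `L¹`. -/
theorem HasSpectralGap.exists_integral_abs_sub_mean_le {α β : X ≃ᵐ X} {C : ℝ}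
    (H : HasSpectralGap μ α β C) (hα : MeasurePreserving α μ μ) (hβ : MeasurePreserving β μ μ) :
    ∃ K : ℝ, 0 < K ∧ ∀ g : X → ℝ, Integrable g μ →
      ∫ x, |g x - ∫ y, g y ∂μ| ∂μ ≤
        K * (∫ x, |g x - g (α x)| ∂μ + ∫ x, |g x - g (β x)| ∂μ) := by
  obtain ⟨K, hK0, hK⟩ := H.exists_integral_abs_rpow_le le_rfl
  refine ⟨K * 2, by positivity, fun g hg => ?_⟩
  set m := ∫ y, g y ∂μ
  have hgm : Integrable (fun x => g x - m) μ := hg.sub (integrable_const m)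
  have hgm1 : MemLp (fun x => g x - m) (ENNReal.ofReal 1) μ := by
    rw [ENNReal.ofReal_one]
    exact memLp_one_iff_integrable.2 hgm
  have h := hK _ hgm1 (by
    rw [integral_sub hg (integrable_const m)]
    simp [m])
  simp only [Real.rpow_one] at h
  have hF := memLp_two_signedPow one_pos hgm1
  have key : ∀ e : X ≃ᵐ X, MeasurePreserving e μ μ →
      ∫ x, (signedPow (1 / 2) (g x - m) - signedPow (1 / 2) (g (e x) - m)) ^ 2 ∂μ ≤
        2 * ∫ x, |g x - g (e x)| ∂μ := by
    intro e he
    have hFe : MemLp (fun x => signedPow (1 / 2) (g (e x) - m)) 2 μ :=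
      hF.comp_measurePreserving he
    have hge : Integrable (fun x => g (e x)) μ := he.integrable_comp_of_integrable hg
    rw [← integral_const_mul]
    refine integral_mono (hF.sub hFe).integrable_sq ((hg.sub hge).abs.const_mul 2) fun x => ?_
    have := sq_signedPow_half_sub_le (g x - m) (g (e x) - m)
    rwa [sub_sub_sub_cancel_right] at this
  have h1 := key α hα
  have h2 := key β hβ
  refine h.trans ?_
  rw [mul_assoc]
  refine mul_le_mul_of_nonneg_left ?_ hK0.le
  linarith

/-- Bounded functionals on `L¹` are given by bounded functions. Restricting the functional to `L²`
makes the density a Riesz representative; testing against indicators bounds it. Only the values on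
indicators are recorded. -/
theorem exists_memLp_top_forall_apply_indicator (φ : StrongDual ℝ (Lp ℝ 1 μ)) :
    ∃ h : X → ℝ, MemLp h ∞ μ ∧ ∀ (s : Set X) (hs : MeasurableSet s),
      φ (indicatorConstLp 1 hs (measure_ne_top μ s) 1) = ∫ x in s, h x ∂μ := by
  have hmem : ∀ g : Lp ℝ 2 μ, MemLp g 1 μ := fun g => (Lp.memLp g).mono_exponent one_le_two
  let ι : Lp ℝ 2 μ →L[ℝ] Lp ℝ 1 μ := LinearMap.mkContinuous
    { toFun := fun g => (hmem g).toLp g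
      map_add' := fun g g' => by
        rw [← MemLp.toLp_add]
        exact MemLp.toLp_congr _ _ (Lp.coeFn_add g g')
      map_smul' := fun c g => by
        rw [RingHom.id_apply, ← MemLp.toLp_const_smul]
        exact MemLp.toLp_congr _ _ (Lp.coeFn_smul c g) } 1 fun g => by
    simp only [LinearMap.coe_mk, AddHom.coe_mk]
    rw [one_mul, Lp.norm_toLp, Lp.norm_def]
    exact ENNReal.toReal_mono (Lp.eLpNorm_ne_top g)
      (eLpNorm_le_eLpNorm_of_exponent_le one_le_two (Lp.aestronglyMeasurable g))
  set h : Lp ℝ 2 μ := (InnerProductSpace.toDual ℝ (Lp ℝ 2 μ)).symm (φ.comp ι)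
  have hφ : ∀ (s : Set X) (hs : MeasurableSet s),
      φ (indicatorConstLp 1 hs (measure_ne_top μ s) 1) = ∫ x in s, h x ∂μ := by
    intro s hs
    have h1 : inner ℝ h (indicatorConstLp 2 hs (measure_ne_top μ s) (1 : ℝ)) =
        φ (ι (indicatorConstLp 2 hs (measure_ne_top μ s) (1 : ℝ))) :=
      InnerProductSpace.toDual_symm_apply
    rw [real_inner_comm, L2.inner_indicatorConstLp_one] at h1
    rw [h1]
    congr 1
    exact (MemLp.toLp_congr (hmem _) _ indicatorConstLp_coeFn).symm
  have hint : Integrable h μ := (Lp.memLp h).integrable one_le_two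
  have hbd : ∀ (s : Set X) (hs : MeasurableSet s), |∫ x in s, h x ∂μ| ≤ ‖φ‖ * μ.real s := by
    intro s hs
    rw [← hφ s hs, ← Real.norm_eq_abs]
    refine (φ.le_opNorm _).trans (le_of_eq ?_)
    rw [norm_indicatorConstLp one_ne_zero ENNReal.one_ne_top]
    simp
  have hc : ∀ (s : Set X) (c : ℝ), ∫ _ in s, c ∂μ = c * μ.real s := fun s c => by
    rw [setIntegral_const, smul_eq_mul, mul_comm]
  have hup : h ≤ᵐ[μ] fun _ => ‖φ‖ :=
    ae_le_of_forall_setIntegral_le hint (integrable_const _) fun s hs _ => by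
      rw [hc]
      exact (le_abs_self _).trans (hbd s hs)
  have hlow : (fun _ => -‖φ‖) ≤ᵐ[μ] h :=
    ae_le_of_forall_setIntegral_le (integrable_const _) hint fun s hs _ => by
      rw [hc, neg_mul]
      exact neg_le_of_abs_le (hbd s hs)
  refine ⟨h, memLp_top_of_bound (Lp.aestronglyMeasurable h) ‖φ‖ ?_, hφ⟩
  filter_upwards [hup, hlow] with x h1 h2
  exact abs_le.2 ⟨h2, h1⟩

theorem l1Pairing_indicatorConstLp {f : X → ℝ} (hf : MemLp f ∞ μ) {s : Set X}
    (hs : MeasurableSet s) :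
    l1Pairing hf (indicatorConstLp 1 hs (measure_ne_top μ s) 1) = ∫ x in s, f x ∂μ := by
  rw [l1Pairing_apply, ← integral_indicator hs]
  refine integral_congr_ae ?_
  filter_upwards [indicatorConstLp_coeFn (p := 1) (hs := hs) (hμs := measure_ne_top μ s)
    (c := (1 : ℝ))] with x hx
  rw [hx]
  by_cases h : x ∈ s <;> simp [h]

theorem exists_abs_integral_mul_le {f : X → ℝ} (hf : MemLp f ∞ μ) (hf0 : ∫ x, f x ∂μ = 0) :
    ∃ M : ℝ, 0 ≤ M ∧ ∀ g : X → ℝ, Integrable g μ →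
      |∫ x, f x * g x ∂μ| ≤ M * ∫ x, |g x - ∫ y, g y ∂μ| ∂μ := by
  refine ⟨(eLpNorm f ∞ μ).toReal, ENNReal.toReal_nonneg, fun g hg => ?_⟩
  set m := ∫ y, g y ∂μ
  have hgm : Integrable (fun x => g x - m) μ := hg.sub (integrable_const m)
  have hfi : Integrable f μ := hf.integrable le_top
  have i1 : Integrable (fun x => f x * g x) μ := hf.integrable_mul (memLp_one_iff_integrable.2 hg)
  have i2 : Integrable (fun x => f x * (g x - m)) μ :=
    hf.integrable_mul (memLp_one_iff_integrable.2 hgm)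
  have e : ∫ x, f x * g x ∂μ = ∫ x, f x * (g x - m) ∂μ := by
    simp_rw [mul_sub]
    rw [integral_sub i1 (hfi.mul_const m), integral_mul_const, hf0, zero_mul, sub_zero]
  rw [e, ← integral_const_mul]
  refine (abs_integral_le_integral_abs).trans
    (integral_mono_ae i2.abs (hgm.abs.const_mul _) ?_)
  have hb : ∀ᵐ x ∂μ, ‖f x‖ ≤ (eLpNorm f ∞ μ).toReal := by
    have h := ae_le_eLpNormEssSup (f := f) (μ := μ)
    filter_upwards [h] with x hx
    rw [← eLpNorm_exponent_top] at hx
    rw [← toReal_enorm]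
    exact ENNReal.toReal_mono hf.2.ne hx
  filter_upwards [hb] with x hx
  rw [abs_mul]
  exact mul_le_mul_of_nonneg_right hx (abs_nonneg _)

theorem koopman_indicatorConstLp {e : X → X} (he : MeasurePreserving e μ μ) {s : Set X}
    (hs : MeasurableSet s) :
    koopman 1 he (indicatorConstLp 1 hs (measure_ne_top μ s) 1) =
      indicatorConstLp 1 (he.measurable hs) (measure_ne_top μ _) 1 :=
  (Lp.indicatorConstLp_compMeasurePreserving hs (measure_ne_top μ s) 1 he)

/-- On a probability space with a spectral gap, every bounded mean-zero function is a sum of two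
bounded coboundaries. The statement is dual to the `L¹` Poincaré inequality: pairing with `f` is
dominated by the norm of the displacement `g ↦ (g - U_α g, g - U_β g)` on `L¹`, so it extends to a
functional on `L¹ × L¹`, whose two densities are the transfer functions up to a translation. -/
theorem HasSpectralGap.exists_coboundaries_top {α β : X ≃ᵐ X} {C : ℝ}
    (H : HasSpectralGap μ α β C) (hα : MeasurePreserving α μ μ) (hβ : MeasurePreserving β μ μ)
    {f : X → ℝ} (hf : MemLp f ∞ μ) (hf0 : ∫ x, f x ∂μ = 0) :
    ∃ h₁ h₂ : X → ℝ, MemLp h₁ ∞ μ ∧ MemLp h₂ ∞ μ ∧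
      ∀ᵐ x ∂μ, f x = h₁ x - h₁ (α x) + h₂ x - h₂ (β x) := by
  obtain ⟨K, hK0, hK⟩ := H.exists_integral_abs_sub_mean_le hα hβ
  obtain ⟨M, hM0, hM⟩ := exists_abs_integral_mul_le hf hf0
  let S : Lp ℝ 1 μ →ₗ[ℝ] Lp ℝ 1 μ × Lp ℝ 1 μ :=
    (LinearMap.id - (koopman 1 hα : Lp ℝ 1 μ →ₗ[ℝ] Lp ℝ 1 μ)).prod
      (LinearMap.id - (koopman 1 hβ : Lp ℝ 1 μ →ₗ[ℝ] Lp ℝ 1 μ))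
  have hS : ∀ g, S g = (g - koopman 1 hα g, g - koopman 1 hβ g) := fun g => rfl
  obtain ⟨φ, hφ⟩ := exists_strongDual_comp_eq S (l1Pairing hf) (M * (K * 2)) (by
    intro g
    have hg : Integrable g μ := L1.integrable_coeFn g
    have h1 := norm_fst_le (S g)
    have h2 := norm_snd_le (S g)
    rw [hS] at h1 h2 ⊢
    simp only [norm_sub_koopman_eq] at h1 h2
    rw [l1Pairing_apply, mul_assoc, mul_assoc]
    refine (hM g hg).trans (mul_le_mul_of_nonneg_left ((hK g hg).trans
      (mul_le_mul_of_nonneg_left ?_ hK0.le)) hM0)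
    linarith)
  obtain ⟨k₁, hk₁, H₁⟩ := exists_memLp_top_forall_apply_indicator
    (φ.comp (ContinuousLinearMap.inl ℝ (Lp ℝ 1 μ) (Lp ℝ 1 μ)))
  obtain ⟨k₂, hk₂, H₂⟩ := exists_memLp_top_forall_apply_indicator
    (φ.comp (ContinuousLinearMap.inr ℝ (Lp ℝ 1 μ) (Lp ℝ 1 μ)))
  have hsplit : ∀ u v : Lp ℝ 1 μ, φ (u, v) =
      φ.comp (ContinuousLinearMap.inl ℝ (Lp ℝ 1 μ) (Lp ℝ 1 μ)) u +
      φ.comp (ContinuousLinearMap.inr ℝ (Lp ℝ 1 μ) (Lp ℝ 1 μ)) v := by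
    intro u v
    have : (u, v) = ((u, 0) : Lp ℝ 1 μ × Lp ℝ 1 μ) + (0, v) := by simp
    rw [this, map_add]
    rfl
  have hk₁' : MemLp (fun x => k₁ (α.symm x)) ∞ μ := hk₁.comp_measurePreserving hα.symm
  have hk₂' : MemLp (fun x => k₂ (β.symm x)) ∞ μ := hk₂.comp_measurePreserving hβ.symm
  have j₁ := hk₁.integrable le_top
  have j₂ := hk₂.integrable le_top
  have j₁' := hk₁'.integrable le_top
  have j₂' := hk₂'.integrable le_top
  have hpre : ∀ (e : X ≃ᵐ X), MeasurePreserving e μ μ → ∀ (k : X → ℝ) (s : Set X),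
      ∫ x in e ⁻¹' s, k x ∂μ = ∫ x in s, k (e.symm x) ∂μ := by
    intro e he k s
    have := he.setIntegral_preimage_emb e.measurableEmbedding (fun x => k (e.symm x)) s
    simpa using this
  -- compare the integrals over each set, moving the transformations from the sets to the densities
  have hae : f =ᵐ[μ] fun x => (k₁ x - k₁ (α.symm x)) + (k₂ x - k₂ (β.symm x)) := by
    have i₁ : Integrable (fun x => k₁ x - k₁ (α.symm x)) μ := j₁.sub j₁'
    have i₂ : Integrable (fun x => k₂ x - k₂ (β.symm x)) μ := j₂.sub j₂'
    refine Integrable.ae_eq_of_forall_setIntegral_eq _ _ (hf.integrable le_top) (i₁.add i₂)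
      fun s hs _ => ?_
    have h := hφ (indicatorConstLp 1 hs (measure_ne_top μ s) 1)
    rw [l1Pairing_indicatorConstLp, hS, hsplit, koopman_indicatorConstLp hα hs,
      koopman_indicatorConstLp hβ hs, map_sub, map_sub, H₁, H₁, H₂, H₂, hpre α hα, hpre β hβ] at h
    rw [← h, integral_add i₁.integrableOn i₂.integrableOn,
      integral_sub j₁.integrableOn j₁'.integrableOn, integral_sub j₂.integrableOn j₂'.integrableOn]
  refine ⟨_, _, hk₁'.neg, hk₂'.neg, ?_⟩
  filter_upwards [hae] with x hx
  simp only [Pi.neg_apply, MeasurableEquiv.symm_apply_apply]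
  rw [hx]
  ring

end

/-! ### The spectral gap on the lattice -/

/-- The linear automorphism `(m, n) ↦ (m - n, n)` of `ℤ²`, dual to the shear of the torus. -/
def shearInt : ℤ × ℤ ≃ ℤ × ℤ where
  toFun p := (p.1 - p.2, p.2)
  invFun p := (p.1 + p.2, p.2)
  left_inv p := by simp
  right_inv p := by simp

section

variable {ι : Type*} {b : ι → ℝ}

theorem tsum_indicator_add_tsum_indicator_le (hb0 : ∀ p, 0 ≤ b p) (hb : Summable b) {S T R : Set ι}
    (hST : ∀ p ∈ S, p ∉ T) (hS : S ⊆ R) (hT : T ⊆ R) :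
    ∑' p, S.indicator b p + ∑' p, T.indicator b p ≤ ∑' p, R.indicator b p := by
  rw [← (hb.indicator S).tsum_add (hb.indicator T)]
  refine ((hb.indicator S).add (hb.indicator T)).tsum_le_tsum (fun p => ?_) (hb.indicator R)
  by_cases h1 : p ∈ S
  · simp [h1, hST p h1, hS h1]
  · by_cases h2 : p ∈ T
    · simp [h1, h2, hT h2]
    · simp [h1, h2, Set.indicator_apply_nonneg fun _ => hb0 p]

/-- The mass of a set changes under a permutation by at most the `ℓ¹` displacement. -/
theorem abs_tsum_indicator_sub_preimage_le (hb : Summable b) (e : ι ≃ ι) (S : Set ι) :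
    |∑' p, S.indicator b p - ∑' p, (e ⁻¹' S).indicator b p| ≤ ∑' p, |b p - b (e p)| := by
  have hbe : Summable fun p => b (e p) := e.summable_iff.2 hb
  have hSe : Summable fun p => S.indicator b (e p) := e.summable_iff.2 (hb.indicator S)
  rw [← e.tsum_eq (S.indicator b), ← hSe.tsum_sub (hb.indicator _)]
  have hs : Summable fun p => |b p - b (e p)| := (hb.sub hbe).abs
  rw [← Real.norm_eq_abs]
  refine tsum_of_norm_bounded hs.hasSum fun p => ?_
  rw [Real.norm_eq_abs]
  by_cases h : e p ∈ S
  · have h' : p ∈ e ⁻¹' S := h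
    rw [Set.indicator_of_mem h, Set.indicator_of_mem h', abs_sub_comm]
  · have h' : p ∉ e ⁻¹' S := h
    rw [Set.indicator_of_notMem h, Set.indicator_of_notMem h', sub_zero, abs_zero]
    exact abs_nonneg _

end

/-- The `ℓ¹` isoperimetric inequality on `ℤ² \ {0}`. The shear maps the open quadrants `m n < 0`
into their part `|m| > |n|`, which the swap makes disjoint from itself, so these quadrants carry
little mass; the inverse shear does the same for `m n > 0`, and the axes are treated likewise. -/
theorem tsum_le_of_apply_zero_eq_zero {b : ℤ × ℤ → ℝ} (hb0 : ∀ p, 0 ≤ b p) (hb : Summable b)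
    (h0 : b 0 = 0) :
    ∑' p, b p ≤ 3 * ∑' p, |b p - b p.swap| + 6 * ∑' p, |b p - b (shearInt p)| := by
  set D := ∑' p : ℤ × ℤ, |b p - b p.swap|
  set E := ∑' p, |b p - b (shearInt p)|
  let ν : Set (ℤ × ℤ) → ℝ := fun S => ∑' p, S.indicator b p
  have hadd : ∀ {S T R : Set (ℤ × ℤ)}, (∀ p ∈ S, p ∉ T) → S ⊆ R → T ⊆ R → ν S + ν T ≤ ν R :=
    fun h1 h2 h3 => tsum_indicator_add_tsum_indicator_le hb0 hb h1 h2 h3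
  have hD : ∀ S T : Set (ℤ × ℤ), (∀ p, p.swap ∈ S ↔ p ∈ T) → |ν S - ν T| ≤ D := by
    intro S T h
    have e : (Equiv.prodComm ℤ ℤ) ⁻¹' S = T := Set.ext h
    rw [← e]
    exact abs_tsum_indicator_sub_preimage_le hb (Equiv.prodComm ℤ ℤ) S
  have hE : ∀ S T : Set (ℤ × ℤ), (∀ p, shearInt p ∈ S ↔ p ∈ T) → |ν S - ν T| ≤ E := by
    intro S T h
    have e : shearInt ⁻¹' S = T := Set.ext h
    rw [← e]
    exact abs_tsum_indicator_sub_preimage_le hb shearInt S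
  -- `A`, `B` are the images of `N` under the shear and of `P` under its inverse, and `A'`, `B'` are
  -- their mirror images; `G` is the image of `NY = N ∪ Y` and is contained in `N`
  let P : Set (ℤ × ℤ) := {p | 0 < p.1 * p.2}
  let N : Set (ℤ × ℤ) := {p | p.1 * p.2 < 0}
  let Y : Set (ℤ × ℤ) := {p | p.1 = 0 ∧ p.2 ≠ 0}
  let Z : Set (ℤ × ℤ) := {p | p.2 = 0 ∧ p.1 ≠ 0}
  let A : Set (ℤ × ℤ) := {p | p.1 * p.2 + p.2 * p.2 < 0}
  let A' : Set (ℤ × ℤ) := {p | p.1 * p.2 + p.1 * p.1 < 0}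
  let B : Set (ℤ × ℤ) := {p | 0 < p.1 * p.2 - p.2 * p.2}
  let B' : Set (ℤ × ℤ) := {p | 0 < p.1 * p.2 - p.1 * p.1}
  let G : Set (ℤ × ℤ) := {p | p.1 * p.2 + p.2 * p.2 ≤ 0 ∧ p.2 ≠ 0}
  let NY : Set (ℤ × ℤ) := {p | p.1 * p.2 ≤ 0 ∧ p.2 ≠ 0}
  have hN : ν N ≤ 2 * E + D := by
    have h1 := abs_le.1 (hE A N fun p => by
      simp only [shearInt, Equiv.coe_fn_mk, A, N, Set.mem_ofPred_eq]
      ring_nf)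
    have h2 := abs_le.1 (hD A A' fun p => by
      simp only [A, A', Set.mem_ofPred_eq, Prod.fst_swap, Prod.snd_swap]
      ring_nf)
    have h3 : ν A + ν A' ≤ ν N := by
      refine hadd (fun p hp hp' => ?_) (fun p hp => ?_) (fun p hp => ?_)
      · simp only [A, A', Set.mem_ofPred_eq] at hp hp'
        nlinarith [sq_nonneg (p.1 + p.2)]
      · simp only [A, N, Set.mem_ofPred_eq] at hp ⊢
        nlinarith [mul_self_nonneg p.2]
      · simp only [A', N, Set.mem_ofPred_eq] at hp ⊢
        nlinarith [mul_self_nonneg p.1]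
    linarith [h1.1, h2.2]
  have hP : ν P ≤ 2 * E + D := by
    have h1 := abs_le.1 (hE P B fun p => by
      simp only [shearInt, Equiv.coe_fn_mk, P, B, Set.mem_ofPred_eq]
      ring_nf)
    have h2 := abs_le.1 (hD B B' fun p => by
      simp only [B, B', Set.mem_ofPred_eq, Prod.fst_swap, Prod.snd_swap]
      ring_nf)
    have h3 : ν B + ν B' ≤ ν P := by
      refine hadd (fun p hp hp' => ?_) (fun p hp => ?_) (fun p hp => ?_)
      · simp only [B, B', Set.mem_ofPred_eq] at hp hp'
        nlinarith [sq_nonneg (p.1 - p.2)]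
      · simp only [B, P, Set.mem_ofPred_eq] at hp ⊢
        nlinarith [mul_self_nonneg p.2]
      · simp only [B', P, Set.mem_ofPred_eq] at hp ⊢
        nlinarith [mul_self_nonneg p.1]
    linarith [h1.2, h2.2]
  have hY : ν Y ≤ E := by
    have h1 := abs_le.1 (hE G NY fun p => by
      simp only [shearInt, Equiv.coe_fn_mk, G, NY, Set.mem_ofPred_eq]
      ring_nf)
    have h2 : ν N + ν Y ≤ ν NY := by
      refine hadd (fun p hp hp' => ?_) (fun p hp => ?_) (fun p hp => ?_)
      · simp only [N, Y, Set.mem_ofPred_eq] at hp hp'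
        simp [hp'.1] at hp
      · simp only [N, NY, Set.mem_ofPred_eq] at hp ⊢
        exact ⟨hp.le, fun h => by simp [h] at hp⟩
      · simp only [Y, NY, Set.mem_ofPred_eq] at hp ⊢
        exact ⟨by simp [hp.1], hp.2⟩
    have h3 : ν G + ν ∅ ≤ ν N := by
      refine hadd (fun p hp hp' => hp'.elim) (fun p hp => ?_) (Set.empty_subset _)
      simp only [G, N, Set.mem_ofPred_eq] at hp ⊢
      have : 0 < p.2 * p.2 := mul_self_pos.2 hp.2
      linarith
    have h4 : ν ∅ = 0 := by simp [ν]
    linarith [h1.1]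
  have hZ : ν Z ≤ E + D := by
    have h1 := abs_le.1 (hD Z Y fun p => by
      simp only [Z, Y, Set.mem_ofPred_eq, Prod.fst_swap, Prod.snd_swap])
    linarith [h1.2]
  have htot : ∑' p, b p ≤ ν P + ν N + ν Y + ν Z := by
    have s1 := (hb.indicator P).add (hb.indicator N)
    have s2 := s1.add (hb.indicator Y)
    simp only [ν]
    rw [← (hb.indicator P).tsum_add (hb.indicator N), ← s1.tsum_add (hb.indicator Y),
      ← s2.tsum_add (hb.indicator Z)]
    refine hb.tsum_le_tsum (fun p => ?_) (s2.add (hb.indicator Z))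
    have nP := Set.indicator_apply_nonneg (s := P) fun _ => hb0 p
    have nN := Set.indicator_apply_nonneg (s := N) fun _ => hb0 p
    have nY := Set.indicator_apply_nonneg (s := Y) fun _ => hb0 p
    have nZ := Set.indicator_apply_nonneg (s := Z) fun _ => hb0 p
    rcases lt_trichotomy 0 (p.1 * p.2) with h | h | h
    · have := Set.indicator_of_mem (show p ∈ P from h) b
      linarith
    · rcases mul_eq_zero.1 h.symm with h1 | h1
      · by_cases h2 : p.2 = 0
        · have : p = 0 := Prod.ext h1 h2
          rw [this] at nP nN nY nZ ⊢
          linarith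
        · have := Set.indicator_of_mem (show p ∈ Y from ⟨h1, h2⟩) b
          linarith
      · by_cases h2 : p.1 = 0
        · have : p = 0 := Prod.ext h2 h1
          rw [this] at nP nN nY nZ ⊢
          linarith
        · have := Set.indicator_of_mem (show p ∈ Z from ⟨h1, h2⟩) b
          linarith
    · have := Set.indicator_of_mem (show p ∈ N from h) b
      linarith
  linarith

/-- The displacement of `‖a‖²` in `ℓ¹` against that of `a` in `ℓ²`. -/
theorem tsum_abs_sq_sub_le {ι : Type*} {a : ι → ℂ} (ha : Summable fun p => ‖a p‖ ^ 2) (e : ι ≃ ι)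
    {δ : ℝ} (hδ : 0 < δ) :
    ∑' p, |‖a p‖ ^ 2 - ‖a (e p)‖ ^ 2| ≤
      δ⁻¹ * ∑' p, ‖a p - a (e p)‖ ^ 2 + δ * ∑' p, ‖a p‖ ^ 2 := by
  have hae : Summable fun p => ‖a (e p)‖ ^ 2 := e.summable_iff.2 ha
  have hd : Summable fun p => ‖a p - a (e p)‖ ^ 2 := by
    refine ((ha.mul_left 2).add (hae.mul_left 2)).of_nonneg_of_le (fun p => by positivity)
      fun p => ?_
    have := norm_sub_le (a p) (a (e p))
    nlinarith [sq_nonneg (‖a p‖ - ‖a (e p)‖), norm_nonneg (a p - a (e p)), norm_nonneg (a p),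
      norm_nonneg (a (e p))]
  have hle : ∀ p, |‖a p‖ ^ 2 - ‖a (e p)‖ ^ 2| ≤
      δ⁻¹ * ‖a p - a (e p)‖ ^ 2 + (δ / 2 * ‖a p‖ ^ 2 + δ / 2 * ‖a (e p)‖ ^ 2) := by
    intro p
    set x := ‖a p‖
    set y := ‖a (e p)‖
    set d := ‖a p - a (e p)‖
    have h1 : |x - y| ≤ d := abs_norm_sub_norm_le _ _
    have hx : 0 ≤ x := norm_nonneg _
    have hy : 0 ≤ y := norm_nonneg _
    have h2 : |x ^ 2 - y ^ 2| ≤ d * (x + y) := by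
      rw [sq_sub_sq, abs_mul, abs_of_nonneg (add_nonneg hx hy), mul_comm]
      exact mul_le_mul_of_nonneg_right h1 (add_nonneg hx hy)
    have h3 : d * (x + y) ≤ δ⁻¹ * d ^ 2 + δ / 4 * (x + y) ^ 2 := by
      have : δ⁻¹ * d ^ 2 + δ / 4 * (x + y) ^ 2 - d * (x + y) =
          δ⁻¹ * (d - δ / 2 * (x + y)) ^ 2 := by
        field_simp
        ring
      have h4 : 0 ≤ δ⁻¹ * (d - δ / 2 * (x + y)) ^ 2 := by positivity
      linarith
    have h5 : δ / 4 * (x + y) ^ 2 ≤ δ / 2 * x ^ 2 + δ / 2 * y ^ 2 := by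
      nlinarith [mul_nonneg hδ.le (sq_nonneg (x - y))]
    linarith
  have hs := (hd.mul_left δ⁻¹).add ((ha.mul_left (δ / 2)).add (hae.mul_left (δ / 2)))
  refine ((hs.of_nonneg_of_le (fun p => abs_nonneg _) hle).tsum_le_tsum hle hs).trans
    (le_of_eq ?_)
  rw [(hd.mul_left δ⁻¹).tsum_add ((ha.mul_left (δ / 2)).add (hae.mul_left (δ / 2))),
    (ha.mul_left (δ / 2)).tsum_add (hae.mul_left (δ / 2)), tsum_mul_left, tsum_mul_left,
    tsum_mul_left, e.tsum_eq fun p => ‖a p‖ ^ 2]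
  ring

/-- Spectral gap of the swap and the shear on `ℓ²(ℤ² \ {0})`. -/
theorem tsum_norm_sq_le_of_apply_zero_eq_zero {a : ℤ × ℤ → ℂ} (ha : Summable fun p => ‖a p‖ ^ 2)
    (h0 : a 0 = 0) :
    ∑' p, ‖a p‖ ^ 2 ≤
      216 * (∑' p, ‖a p - a p.swap‖ ^ 2 + ∑' p, ‖a p - a (shearInt p)‖ ^ 2) := by
  have h := tsum_le_of_apply_zero_eq_zero (b := fun p => ‖a p‖ ^ 2) (fun p => by positivity) ha
    (by simp [h0])
  -- `δ = 1 / 18` makes the error terms add up to half of the left side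
  have h1 := tsum_abs_sq_sub_le ha (Equiv.prodComm ℤ ℤ) (δ := 1 / 18) (by norm_num)
  have h2 := tsum_abs_sq_sub_le ha shearInt (δ := 1 / 18) (by norm_num)
  simp only [Equiv.prodComm_apply] at h1
  have h3 : 0 ≤ ∑' p : ℤ × ℤ, ‖a p - a p.swap‖ ^ 2 := tsum_nonneg fun p => by positivity
  norm_num at h1 h2
  linarith

/-! ### Fourier analysis on the two-torus -/

theorem measurePreserving_toCircle :
    MeasurePreserving (fun t : UnitAddCircle => AddCircle.toCircle t) AddCircle.haarAddCircle
      circleLebesgue := by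
  have hm : Measurable fun t : UnitAddCircle => AddCircle.toCircle t :=
    AddCircle.continuous_toCircle.measurable
  refine ⟨hm, ?_⟩
  rw [circleLebesgue, AddCircle.volume_eq_smul_haarAddCircle, ENNReal.ofReal_one, one_smul]

instance : IsProbabilityMeasure circleLebesgue :=
  measurePreserving_toCircle.map_eq ▸
    Measure.isProbabilityMeasure_map measurePreserving_toCircle.measurable.aemeasurable

instance : IsProbabilityMeasure torusLebesgue :=
  inferInstanceAs (IsProbabilityMeasure (circleLebesgue.prod circleLebesgue))

instance : circleLebesgue.IsMulLeftInvariant where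
  map_mul_left_eq_self g := by
    obtain ⟨s, rfl⟩ := (AddCircle.homeomorphCircle (T := 1) one_ne_zero).surjective g
    have hm := measurePreserving_toCircle
    rw [AddCircle.homeomorphCircle_apply, ← hm.map_eq,
      Measure.map_map (measurable_const_mul _) hm.measurable]
    have e : (fun x => AddCircle.toCircle s * x) ∘ (fun t : UnitAddCircle => AddCircle.toCircle t) =
        (fun t : UnitAddCircle => AddCircle.toCircle t) ∘ fun t => s + t := by
      ext t
      simp [AddCircle.toCircle_add]
    rw [e, ← Measure.map_map hm.measurable (measurable_const_add s), map_add_left_eq_self]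

theorem measurePreserving_torusFlip :
    MeasurePreserving (MeasurableEquiv.prodComm : Circle × Circle ≃ᵐ Circle × Circle)
      torusLebesgue torusLebesgue :=
  Measure.measurePreserving_swap

theorem measurePreserving_torusShear :
    MeasurePreserving (MeasurableEquiv.shearMulRight Circle) torusLebesgue torusLebesgue :=
  measurePreserving_prod_mul circleLebesgue circleLebesgue

theorem coe_prodComm_eq_torusFlip :
    ⇑(MeasurableEquiv.prodComm : Circle × Circle ≃ᵐ Circle × Circle) = torusFlip := rfl

theorem coe_shearMulRight_eq_torusShear :
    ⇑(MeasurableEquiv.shearMulRight Circle) = torusShear := rfl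

/-- The character `(x, y) ↦ x ^ m * y ^ n` of the two-torus. -/
noncomputable def torusChar (p : ℤ × ℤ) (z : Circle × Circle) : Circle := z.1 ^ p.1 * z.2 ^ p.2

theorem continuous_torusChar (p : ℤ × ℤ) : Continuous (torusChar p) := by
  unfold torusChar
  fun_prop

theorem torusChar_torusFlip (p : ℤ × ℤ) (z : Circle × Circle) :
    torusChar p.swap (torusFlip z) = torusChar p z := by
  simp [torusChar, torusFlip, mul_comm]

theorem torusChar_torusShear (p : ℤ × ℤ) (z : Circle × Circle) :
    torusChar (shearInt p) (torusShear z) = torusChar p z := by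
  simp only [torusChar, torusShear, shearInt, Equiv.coe_fn_mk, mul_zpow]
  rw [← mul_assoc, ← zpow_add, sub_add_cancel]

/-- The Fourier coefficients of a function on the two-torus. -/
noncomputable def torusCoeff (F : Circle × Circle → ℂ) (p : ℤ × ℤ) : ℂ :=
  ∫ z, (torusChar (-p) z : ℂ) * F z ∂torusLebesgue

theorem torusCoeff_zero (F : Circle × Circle → ℂ) :
    torusCoeff F 0 = ∫ z, F z ∂torusLebesgue := by
  simp [torusCoeff, torusChar]

theorem integrable_torusChar_mul {F : Circle × Circle → ℂ} (hF : Integrable F torusLebesgue)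
    (p : ℤ × ℤ) : Integrable (fun z => (torusChar p z : ℂ) * F z) torusLebesgue := by
  refine hF.bdd_mul (c := 1) ?_ (ae_of_all _ fun z => (Circle.norm_coe _).le)
  have hc : Continuous fun w : Circle => (w : ℂ) := continuous_subtype_val
  exact (hc.measurable.comp (continuous_torusChar p).measurable).aestronglyMeasurable

theorem torusCoeff_sub {F G : Circle × Circle → ℂ} (hF : Integrable F torusLebesgue)
    (hG : Integrable G torusLebesgue) (p : ℤ × ℤ) :
    torusCoeff (fun z => F z - G z) p = torusCoeff F p - torusCoeff G p := by
  unfold torusCoeff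
  rw [← integral_sub (integrable_torusChar_mul hF _) (integrable_torusChar_mul hG _)]
  simp_rw [mul_sub]

theorem torusCoeff_comp_torusFlip (F : Circle × Circle → ℂ) (p : ℤ × ℤ) :
    torusCoeff (fun z => F (torusFlip z)) p = torusCoeff F p.swap := by
  unfold torusCoeff
  rw [← measurePreserving_torusFlip.integral_comp' fun z => (torusChar (-p.swap) z : ℂ) * F z]
  refine integral_congr_ae (ae_of_all _ fun z => ?_)
  simp only [coe_prodComm_eq_torusFlip]
  rw [← torusChar_torusFlip (-p)]
  rfl

theorem torusCoeff_comp_torusShear (F : Circle × Circle → ℂ) (p : ℤ × ℤ) :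
    torusCoeff (fun z => F (torusShear z)) p = torusCoeff F (shearInt p) := by
  unfold torusCoeff
  rw [← measurePreserving_torusShear.integral_comp' fun z => (torusChar (-shearInt p) z : ℂ) * F z]
  refine integral_congr_ae (ae_of_all _ fun z => ?_)
  simp only [coe_shearMulRight_eq_torusShear]
  have e : -shearInt p = shearInt (-p) := by
    ext <;> simp [shearInt]
    ring
  rw [e, torusChar_torusShear]

/-- The parametrization of the two-torus by angles. -/
noncomputable def torusParam (t : UnitAddTorus (Fin 2)) : Circle × Circle :=
  (AddCircle.toCircle (t 0), AddCircle.toCircle (t 1))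

theorem measurePreserving_torusParam :
    MeasurePreserving torusParam (Measure.pi fun _ : Fin 2 => AddCircle.haarAddCircle)
      torusLebesgue :=
  (measurePreserving_toCircle.prod measurePreserving_toCircle).comp
    (measurePreserving_finTwoArrow AddCircle.haarAddCircle)

/-- Parseval's identity on the two-torus. -/
theorem hasSum_sq_torusCoeff {F : Circle × Circle → ℂ} (hF : MemLp F 2 torusLebesgue) :
    HasSum (fun p => ‖torusCoeff F p‖ ^ 2) (∫ z, ‖F z‖ ^ 2 ∂torusLebesgue) := by
  have hmp := measurePreserving_torusParam
  have hFt : MemLp (fun t => F (torusParam t)) 2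
      (Measure.pi fun _ : Fin 2 => AddCircle.haarAddCircle) := hF.comp_measurePreserving hmp
  have hint : Integrable F torusLebesgue := hF.integrable one_le_two
  -- the volume in this lemma is by definition the product of the Haar probability measures
  have h := UnitAddTorus.hasSum_sq_mFourierCoeff (hFt.toLp _)
  have h1 : ∫ z, ‖F z‖ ^ 2 ∂torusLebesgue =
      ∫ t, ‖hFt.toLp _ t‖ ^ 2 ∂(Measure.pi fun _ : Fin 2 => AddCircle.haarAddCircle) := by
    rw [← hmp.map_eq, integral_map hmp.measurable.aemeasurable]
    · refine integral_congr_ae ?_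
      filter_upwards [hFt.coeFn_toLp] with t ht
      rw [ht]
    · rw [hmp.map_eq]
      exact (hF.1.norm.pow 2)
  rw [h1, ← (finTwoArrowEquiv ℤ).hasSum_iff]
  refine h.congr_fun fun n => ?_
  rw [Function.comp_apply]
  congr 2
  unfold torusCoeff UnitAddTorus.mFourierCoeff
  rw [← hmp.map_eq, integral_map hmp.measurable.aemeasurable]
  · refine integral_congr_ae ?_
    filter_upwards [hFt.coeFn_toLp] with t ht
    rw [ht]
    simp only [UnitAddTorus.mFourier, ContinuousMap.coe_mk, Fin.prod_univ_two, fourier_apply,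
      AddCircle.toCircle_zsmul, torusChar, torusParam, smul_eq_mul, Circle.coe_mul]
    rfl
  · rw [hmp.map_eq]
    exact (integrable_torusChar_mul hint _).1

theorem integral_norm_sq_sub_comp_eq_tsum {F : Circle × Circle → ℂ} (hF : MemLp F 2 torusLebesgue)
    {e : Circle × Circle → Circle × Circle} (he : MeasurePreserving e torusLebesgue torusLebesgue)
    {σ : ℤ × ℤ → ℤ × ℤ} (hσ : ∀ p, torusCoeff (fun z => F (e z)) p = torusCoeff F (σ p)) :
    ∫ z, ‖F z - F (e z)‖ ^ 2 ∂torusLebesgue =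
      ∑' p, ‖torusCoeff F p - torusCoeff F (σ p)‖ ^ 2 := by
  have hFe : MemLp (fun z => F (e z)) 2 torusLebesgue := hF.comp_measurePreserving he
  refine (hasSum_sq_torusCoeff (hF.sub hFe)).tsum_eq.symm.trans (tsum_congr fun p => ?_)
  rw [← hσ, ← torusCoeff_sub (hF.integrable one_le_two) (hFe.integrable one_le_two)]
  rfl

/-- The flip and the shear have a spectral gap on the two-torus. -/
theorem hasSpectralGap_torus :
    HasSpectralGap torusLebesgue (MeasurableEquiv.prodComm : Circle × Circle ≃ᵐ Circle × Circle)
      (MeasurableEquiv.shearMulRight Circle) 216 := by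
  intro u hu hu0
  have hF : MemLp (fun z => (u z : ℂ)) 2 torusLebesgue := hu.ofReal
  have h := hasSum_sq_torusCoeff hF
  have h0 : torusCoeff (fun z => (u z : ℂ)) 0 = 0 := by
    rw [torusCoeff_zero, integral_complex_ofReal, hu0, Complex.ofReal_zero]
  have key := tsum_norm_sq_le_of_apply_zero_eq_zero h.summable h0
  rw [h.tsum_eq, ← integral_norm_sq_sub_comp_eq_tsum hF measurePreserving_torusFlip
    (torusCoeff_comp_torusFlip fun z => (u z : ℂ)), ← integral_norm_sq_sub_comp_eq_tsum hF
    measurePreserving_torusShear (torusCoeff_comp_torusShear fun z => (u z : ℂ))] at key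
  simpa only [← Complex.ofReal_sub, Complex.norm_real, Real.norm_eq_abs, sq_abs] using key

/-! ### Coboundaries on the two-torus -/

/-- Decomposition of real mean-zero functions on the two-torus into coboundaries. -/
theorem exists_torus_coboundaries_real {r : ℝ≥0∞} (hr : 1 < r) {f : Circle × Circle → ℝ}
    (hf : MemLp f r torusLebesgue) (hmean : ∫ z, f z ∂torusLebesgue = 0) :
    ∃ h₁ h₂ : Circle × Circle → ℝ, MemLp h₁ r torusLebesgue ∧ MemLp h₂ r torusLebesgue ∧
      ∀ᵐ z ∂torusLebesgue, f z = h₁ z - h₁ (torusFlip z) + h₂ z - h₂ (torusShear z) := by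
  rcases eq_or_ne r ∞ with rfl | hr'
  · exact hasSpectralGap_torus.exists_coboundaries_top measurePreserving_torusFlip
      measurePreserving_torusShear hf hmean
  · rw [← ENNReal.ofReal_toReal hr'] at hf ⊢
    refine hasSpectralGap_torus.exists_coboundaries_of_lt_top measurePreserving_torusFlip
      measurePreserving_torusShear ?_ hf hmean
    rwa [← ENNReal.toReal_one, ENNReal.toReal_lt_toReal ENNReal.one_ne_top hr']

theorem mainTheorem7 {𝕜 : Type*} [RCLike 𝕜] (r : ℝ≥0∞) (hr : 1 < r)
    (f : Circle × Circle → 𝕜) (hf : MemLp f r torusLebesgue)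
    (hmean : ∫ z, f z ∂torusLebesgue = 0) :
    ∃ h₁ h₂ : Circle × Circle → 𝕜,
      MemLp h₁ r torusLebesgue ∧ MemLp h₂ r torusLebesgue ∧
      ∀ᵐ z ∂torusLebesgue,
        f z = h₁ z - h₁ (torusFlip z) + h₂ z - h₂ (torusShear z) := by
  have hfi : Integrable f torusLebesgue := hf.integrable hr.le
  obtain ⟨a₁, a₂, ha₁, ha₂, ha⟩ := exists_torus_coboundaries_real hr hf.re (by
    rw [integral_re hfi, hmean, map_zero])
  obtain ⟨b₁, b₂, hb₁, hb₂, hb⟩ := exists_torus_coboundaries_real hr hf.im (by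
    rw [integral_im hfi, hmean, map_zero])
  have hmem : ∀ {a b : Circle × Circle → ℝ}, MemLp a r torusLebesgue → MemLp b r torusLebesgue →
      MemLp (fun z => (a z : 𝕜) + (RCLike.I : 𝕜) * (b z : 𝕜)) r torusLebesgue :=
    fun ha hb => MemLp.add ha.ofReal (MemLp.const_mul hb.ofReal RCLike.I)
  refine ⟨_, _, hmem ha₁ hb₁, hmem ha₂ hb₂, ?_⟩
  filter_upwards [ha, hb] with z h1 h2
  rw [← RCLike.re_add_im (f z), h1, h2]
  simp only [RCLike.ofReal_add, RCLike.ofReal_sub]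
  ring
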